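/- **Conventions.** Fix a commutative ring $k$. A *graded ring* is a $\mathbb Z$-graded $k$-algebra $R=\bigoplus_{n\in\mathbb Z}R_n$ (associative, with unit). Let $\mathrm{gr}\text{-}R$ be the category of $\mathbb Z$-graded right $R$-modules with degree-preserving homomorphisms, and write $\hom_R$ for its Hom sets. All equivalences of categories are $k$-linear. The shift functor $\mathcal S_R$ sends $M$ to $M\langle 1\rangle$, where $M\langle 1\rangle_j=M_{j-1}$; it is an autoequivalence of $\mathrm{gr}\text{-}R$. Let $\mathcal F$ be an autoequivalence of $\mathrm{gr}\text{-}R$ with a quasi-inverse $\mathcal F^{-1}$. Put $\mathcal F^0=\mathrm{id}$ and $\mathcal F^{-n}=(\mathcal F^{-1})^n$ for $n>0$. Let $\eta^{ij}:\mathcal F^{i+j}\to\mathcal F^i\mathcal F^j$ ($i,j\in\mathbb Z$) be the natural compatibility isomorphisms built from an isomorphism $\mathrm{id}\cong\mathcal F^{-1}\mathcal F$. They satisfy $\eta^{0j}=\eta^{j0}=\mathrm{id}$ and $$(\eta^{ij}\mathcal F^l)\circ\eta^{i+j,l}=\mathcal F^i(\eta^{jl})\circ\eta^{i,j+l}.$$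 For a graded $R$-module $P$: * $\mathcal F$ is *$P$-generative* if the modules $\mathcal F^nP$, $n\in\mathbb Z$, generate $\mathrm{gr}\text{-}R$. * The *$\mathcal F$-twisted endomorphism ring* is the graded ring $\mathrm{End}^{\mathcal F}_R(P)=\bigoplus_{n\in\mathbb Z}\hom_R(\mathcal F^nP,P)$. The product of $a\in\hom_R(\mathcal F^iP,P)$ and $b\in\hom_R(\mathcal F^jP,P)$ is $a\circ\mathcal F^i(b)\circ\eta^{ij}_P\in\hom_R(\mathcal F^{i+j}P,P)$. * The *$\mathcal F$-twisted Hom functor* $\mathrm{Hom}^{\mathcal F}_R(P,-):\mathrm{gr}\text{-}R\to\mathrm{gr}\text{-}\mathrm{End}^{\mathcal F}_R(P)$ sends $N$ to $\bigoplus_{j\in\mathbb Z}\hom_R(\mathcal F^jP,N)$. An element $b\in\hom_R(\mathcal F^iP,P)$ acts on $f\in\hom_R(\mathcal F^jP,N)$ by $fb=f\circ\mathcal F^j(b)\circ\eta^{ji}_P$. **Theorem.** Let $R$ and $S$ be graded rings. Then $\mathrm{gr}\text{-}R$ and $\mathrm{gr}\text{-}S$ are equivalent if and only if there are 1. a finitely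 generated graded projective right $R$-module $P$ and a $P$-generative autoequivalence $\mathcal F$ of $\mathrm{gr}\text{-}R$ such that 2. $S\cong\mathrm{End}^{\mathcal F}_R(P)$ by a degree-preserving isomorphism of $k$-algebras. Further, if $\Phi:\mathrm{gr}\text{-}R\to\mathrm{gr}\text{-}S$ is an equivalence with quasi-inverse $\Psi$, then $\mathcal F=\Phi^*\mathcal S_S=\Psi\mathcal S_S\Phi$ and $P=\Psi(S)$ satisfy (1) and (2). Moreover, the isomorphism $S\cong\mathrm{End}^{\mathcal F}_R(P)$ in (2) can be chosen so that $\Phi$ is naturally isomorphic to $\mathrm{Hom}^{\mathcal F}_R(P,-)$, its values being regarded as graded $S$-modules through that isomorphism. -/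

import Mathlib

open CategoryTheory DirectSum

universe v u w w'

/-! ### Integer powers of an autoequivalence and their compatibility isomorphisms -/

section Powers

variable {C : Type w} [Category.{w'} C]

/-- A `ℤ`-sequence of endofunctors `F_i` with compatibility isomorphisms
`η^{ij} : F_{i+j} ≅ F_i F_j`, normalised so that `F_0` is the identity and `η^{0j}`, `η^{j0}` are
identities (up to the chosen identification `F_0 ≅ id`), and coassociative.
To avoid transports, `η^{ij}` is indexed by `l` together with a proof of `i + j = l`. Recall that
`G ⋙ F` is "first `G`, then `F`". -/
structure ZSequence (C : Type w) [Category.{w'} C] where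
  functor : ℤ → C ⥤ C
  zero : functor 0 ≅ 𝟭 C
  compat : ∀ {i j l : ℤ}, i + j = l → (functor l ≅ functor j ⋙ functor i)
  compat_zero_left : ∀ (j : ℤ) (X : C),
    (compat (zero_add j)).hom.app X ≫ zero.hom.app ((functor j).obj X) = 𝟙 _
  compat_zero_right : ∀ (j : ℤ) (X : C),
    (compat (add_zero j)).hom.app X ≫ (functor j).map (zero.hom.app X) = 𝟙 _
  compat_assoc : ∀ {i j l p q r : ℤ} (hp : i + j = p) (hpl : p + l = r) (hq : j + l = q)
    (hiq : i + q = r) (X : C),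
    (compat hpl).hom.app X ≫ (compat hp).hom.app ((functor l).obj X) =
      (compat hiq).hom.app X ≫ (functor i).map ((compat hq).hom.app X)

namespace ZSequence

section Families

variable (F : C ≌ C) {A B : ℤ → C ⥤ C} (a : ∀ n, A (n + 1) ≅ F.functor ⋙ A n)
  (b : ∀ n, B (n + 1) ≅ F.functor ⋙ B n)

lemma family_ext (s t : ∀ n, A n ⟶ B n)
    (hs : ∀ n X, (s (n + 1)).app X ≫ (b n).hom.app X =
      (a n).hom.app X ≫ (s n).app (F.functor.obj X))
    (ht : ∀ n X, (t (n + 1)).app X ≫ (b n).hom.app X =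
      (a n).hom.app X ≫ (t n).app (F.functor.obj X))
    (h0 : s 0 = t 0) (n : ℤ) : s n = t n := by
  have up : ∀ n, s n = t n → s (n + 1) = t (n + 1) := by
    intro n h
    ext X
    rw [← cancel_mono ((b n).hom.app X), hs, ht, h]
  have down : ∀ n, s (n + 1) = t (n + 1) → s n = t n := by
    intro n h
    have key : ∀ X, (s n).app (F.functor.obj X) = (t n).app (F.functor.obj X) := by
      intro X
      rw [← cancel_epi ((a n).hom.app X), ← hs, ← ht, h]
    ext Y
    rw [← cancel_epi ((A n).map (F.counitIso.hom.app Y))]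
    exact ((s n).naturality _).trans ((congrArg (· ≫ _) (key _)).trans ((t n).naturality _).symm)
  induction n using Int.induction_on with
  | zero => exact h0
  | succ i ih => exact up _ ih
  | pred i ih =>
    apply down
    rw [sub_add_cancel]
    exact ih

/-- One step up. -/
def familyUp (n : ℤ) (s : A n ≅ B n) : A (n + 1) ≅ B (n + 1) :=
  a n ≪≫ Functor.isoWhiskerLeft F.functor s ≪≫ (b n).symm

/-- One step down. -/
noncomputable def familyDown (n : ℤ) (s : A (n + 1) ≅ B (n + 1)) : A n ≅ B n :=
  ((Functor.whiskeringLeft C C C).obj F.functor).preimageIso ((a n).symm ≪≫ s ≪≫ b n)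

/-- The family below in nonnegative degrees. -/
def familyNat (s : A 0 ≅ B 0) : ∀ n : ℕ, A (Int.ofNat n) ≅ B (Int.ofNat n)
  | 0 => s
  | n + 1 => familyUp F a b (Int.ofNat n) (familyNat s n)

/-- The family below in negative degrees. -/
noncomputable def familyNeg (s : A 0 ≅ B 0) : ∀ n : ℕ, A (Int.negSucc n) ≅ B (Int.negSucc n)
  | 0 => familyDown F a b (Int.negSucc 0) s
  | n + 1 => familyDown F a b (Int.negSucc (n + 1)) (familyNeg s n)

/-- Extend an isomorphism `A 0 ≅ B 0` to a family `A n ≅ B n`, compatibly with `a` and `b`. -/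
noncomputable def family (s : A 0 ≅ B 0) : ∀ n, A n ≅ B n
  | Int.ofNat n => familyNat F a b s n
  | Int.negSucc n => familyNeg F a b s n

lemma familyUp_spec (n : ℤ) (s : A n ≅ B n) (X : C) :
    (familyUp F a b n s).hom.app X ≫ (b n).hom.app X =
      (a n).hom.app X ≫ s.hom.app (F.functor.obj X) := by
  simp [familyUp]

lemma familyDown_spec (n : ℤ) (s : A (n + 1) ≅ B (n + 1)) (X : C) :
    s.hom.app X ≫ (b n).hom.app X =
      (a n).hom.app X ≫ (familyDown F a b n s).hom.app (F.functor.obj X) := by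
  have h : ((Functor.whiskeringLeft C C C).obj F.functor).map (familyDown F a b n s).hom =
      (a n).inv ≫ s.hom ≫ (b n).hom := by
    exact Functor.map_preimage _ _
  have h2 := NatTrans.congr_app h X
  simp only [Functor.whiskeringLeft_obj_map, Functor.whiskerLeft_app, NatTrans.comp_app] at h2
  rw [h2]
  simp

lemma family_spec (s : A 0 ≅ B 0) (n : ℤ) (X : C) :
    (family F a b s (n + 1)).hom.app X ≫ (b n).hom.app X =
      (a n).hom.app X ≫ (family F a b s n).hom.app (F.functor.obj X) := by
  match n with
  | Int.ofNat n => exact familyUp_spec F a b (Int.ofNat n) (familyNat F a b s n) X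
  | Int.negSucc 0 => exact familyDown_spec F a b (Int.negSucc 0) s X
  | Int.negSucc (n + 1) =>
    exact familyDown_spec F a b (Int.negSucc (n + 1)) (familyNeg F a b s n) X

end Families

variable (F : C ≌ C)

/-- `F^{n+1} ≅ F^n F`; for negative `n` this uses the unit `id ≅ F⁻¹ F`. -/
def powSucc : ∀ n : ℤ, (F ^ (n + 1)).functor ≅ F.functor ⋙ (F ^ n).functor
  | Int.ofNat 0 => (Functor.rightUnitor F.functor).symm
  | Int.ofNat (n + 1) => Iso.refl (F.functor ⋙ (F.powNat (n + 1)).functor)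
  | Int.negSucc 0 => F.unitIso
  | Int.negSucc (n + 1) =>
    (Functor.leftUnitor (F.symm.powNat (n + 1)).functor).symm ≪≫
      Functor.isoWhiskerRight F.unitIso (F.symm.powNat (n + 1)).functor ≪≫
        Functor.associator F.functor F.inverse (F.symm.powNat (n + 1)).functor

/-- The same with the index `m = n + 1` free. -/
def powSuccOf {n m : ℤ} (h : n + 1 = m) : (F ^ m).functor ≅ F.functor ⋙ (F ^ n).functor :=
  eqToIso (by rw [h]) ≪≫ powSucc F n

/-- `F^{i+j} ≅ F^i F^j`, by recursion on `j`, the identity for `j = 0`. -/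
noncomputable def powAdd (i j : ℤ) : (F ^ (i + j)).functor ≅ (F ^ j).functor ⋙ (F ^ i).functor :=
  family F (A := fun j => (F ^ (i + j)).functor) (B := fun j => (F ^ j).functor ⋙ (F ^ i).functor)
    (fun j => powSuccOf F (add_assoc i j 1))
    (fun j => Functor.isoWhiskerRight (powSucc F j) (F ^ i).functor ≪≫
      Functor.associator F.functor (F ^ j).functor (F ^ i).functor)
    (eqToIso (by rw [add_zero]) ≪≫ (Functor.leftUnitor (F ^ i).functor).symm) j

/-- The same with the index `l = i + j` free. -/
noncomputable def powCompat {i j l : ℤ} (h : i + j = l) :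
    (F ^ l).functor ≅ (F ^ j).functor ⋙ (F ^ i).functor :=
  eqToIso (by rw [h]) ≪≫ powAdd F i j

lemma powCompat_succ {i j l j' l' : ℤ} (h : i + j = l) (h' : i + j' = l') (hj : j + 1 = j')
    (hl : l + 1 = l') (X : C) :
    (powCompat F h').hom.app X ≫ (F ^ i).functor.map ((powSuccOf F hj).hom.app X) =
      (powSuccOf F hl).hom.app X ≫ (powCompat F h).hom.app (F.functor.obj X) := by
  subst h hj h'
  have := family_spec F (A := fun j => (F ^ (i + j)).functor)
    (B := fun j => (F ^ j).functor ⋙ (F ^ i).functor)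
    (fun j => powSuccOf F (add_assoc i j 1))
    (fun j => Functor.isoWhiskerRight (powSucc F j) (F ^ i).functor ≪≫
      Functor.associator F.functor (F ^ j).functor (F ^ i).functor)
    (eqToIso (by rw [add_zero]) ≪≫ (Functor.leftUnitor (F ^ i).functor).symm) j X
  simpa [powCompat, powSuccOf, powAdd] using this

lemma powCompat_zero {i : ℤ} (h : i + 0 = i) (X : C) :
    (powCompat F h).hom.app X = 𝟙 ((F ^ i).functor.obj X) := by
  have key : ∀ (G G' : C ⥤ C) (h1 : G = G') (h2 : G' = G),
      (eqToIso h1 ≪≫ eqToIso h2 ≪≫ (Functor.leftUnitor G).symm).hom.app X = 𝟙 (G.obj X) := by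
    intro G G' h1 h2
    subst h1
    simp
  exact key _ _ (by rw [add_zero]) (by rw [add_zero])

lemma powCompat_zero_left (j : ℤ) (X : C) :
    (powCompat F (zero_add j)).hom.app X = 𝟙 ((F ^ j).functor.obj X) := by
  have := family_ext F (A := fun j => (F ^ j).functor) (B := fun j => (F ^ j).functor)
    (powSucc F) (powSucc F) (fun j => (powCompat F (zero_add j)).hom) (fun j => 𝟙 _)
    (fun n X => by
      have h := powCompat_succ F (zero_add n) (zero_add (n + 1)) rfl rfl X
      have e : (powSuccOf F (n := n) rfl) = powSucc F n := by simp [powSuccOf]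
      rw [e] at h
      exact h)
    (fun n X => by simp)
    (by
      ext X
      exact powCompat_zero F (zero_add 0) X) j
  exact NatTrans.congr_app this X

lemma powCompat_assoc_zero {i j p q r : ℤ} (hp : i + j = p) (hpl : p + 0 = r) (hq : j + 0 = q)
    (hiq : i + q = r) (X : C) :
    (powCompat F hpl).hom.app X ≫ (powCompat F hp).hom.app ((F ^ (0 : ℤ)).functor.obj X) =
      (powCompat F hiq).hom.app X ≫ (F ^ i).functor.map ((powCompat F hq).hom.app X) := by
  obtain rfl : j = q := by omega
  obtain rfl : p = r := by omega
  rw [powCompat_zero, powCompat_zero]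
  erw [Category.id_comp, CategoryTheory.Functor.map_id, Category.comp_id]
  rfl

lemma powCompat_assoc {i j l p q r : ℤ} (hp : i + j = p) (hpl : p + l = r) (hq : j + l = q)
    (hiq : i + q = r) (X : C) :
    (powCompat F hpl).hom.app X ≫ (powCompat F hp).hom.app ((F ^ l).functor.obj X) =
      (powCompat F hiq).hom.app X ≫ (F ^ i).functor.map ((powCompat F hq).hom.app X) := by
  subst hp hq hpl
  have := family_ext F (A := fun l => (F ^ (i + j + l)).functor)
    (B := fun l => ((F ^ l).functor ⋙ (F ^ j).functor) ⋙ (F ^ i).functor)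
    (fun l => powSuccOf F (add_assoc (i + j) l 1))
    (fun l => Functor.isoWhiskerRight (Functor.isoWhiskerRight (powSucc F l) (F ^ j).functor)
      (F ^ i).functor)
    (fun l => (powCompat F (i := i + j) (j := l) rfl).hom ≫
      Functor.whiskerLeft (F ^ l).functor (powCompat F (i := i) (j := j) rfl).hom)
    (fun l => (powCompat F (i := i) (j := j + l) (add_assoc i j l).symm).hom ≫
      Functor.whiskerRight (powCompat F (i := j) (j := l) rfl).hom (F ^ i).functor)
    (fun l X => by
      have h := powCompat_succ F (i := i + j) (j := l) rfl rfl rfl (add_assoc (i + j) l 1) X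
      have n := (powCompat F (i := i) (j := j) rfl).hom.naturality
        ((powSuccOf F (n := l) rfl).hom.app X)
      simp only [powSuccOf, eqToIso_refl, Iso.refl_trans] at h n
      simp only [NatTrans.comp_app, Functor.whiskerLeft_app, Functor.isoWhiskerRight_hom,
        Functor.whiskerRight_app, Category.assoc] at h n ⊢
      erw [← n]
      rw [reassoc_of% h]
      rfl)
    (fun l X => by
      have h := powCompat_succ F (i := i) (j := j + l) (j' := j + (l + 1))
        (add_assoc i j l).symm (add_assoc i j (l + 1)).symm (add_assoc j l 1)
        (add_assoc (i + j) l 1) X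
      have h2 := powCompat_succ F (i := j) (j := l) rfl rfl rfl (add_assoc j l 1) X
      have h2' := congrArg ((F ^ i).functor.map) h2
      simp only [Functor.map_comp] at h2'
      have e : (powSuccOf F (n := l) rfl) = powSucc F l := by simp [powSuccOf]
      rw [e] at h2'
      simp only [NatTrans.comp_app, Functor.isoWhiskerRight_hom,
        Functor.whiskerRight_app, Category.assoc]
      erw [h2']
      rw [reassoc_of% h])
    (by
      ext X
      exact powCompat_assoc_zero F rfl rfl rfl (add_assoc i j 0).symm X) l
  exact NatTrans.congr_app this X

/-- The `ℤ`-sequence `{F^n}` of powers of an autoequivalence `F` (given with a quasi-inverse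
`F⁻¹`): `F^0 = id`, `F^1 = F`, `F^n = F ⋯ F`, `F^{-n} = F⁻¹ ⋯ F⁻¹`. -/
noncomputable def ofEquivalence (F : C ≌ C) : ZSequence C where
  functor n := (F ^ n).functor
  zero := Iso.refl _
  compat h := powCompat F h
  compat_zero_left j X := by
    rw [powCompat_zero_left]; exact Category.id_comp _
  compat_zero_right j X := by
    rw [powCompat_zero]
    exact (Category.id_comp _).trans (CategoryTheory.Functor.map_id _ _)
  compat_assoc hp hpl hq hiq X := powCompat_assoc F hp hpl hq hiq X

lemma ofEquivalence_functor (F : C ≌ C) (n : ℤ) :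
    (ofEquivalence F).functor n = (F ^ n).functor := rfl

end ZSequence

end Powers

/-! ### Graded modules -/

/-- The product `𝒜_j × 𝒜_l → 𝒜_{j+l}` of a graded algebra, with `q = j + l` free. -/
def gradedMul {k : Type v} [CommRing k] {R : Type u} [Ring R] [Algebra k R]
    (𝒜 : ℤ → Submodule k R) [GradedAlgebra 𝒜] {j l q : ℤ} (h : j + l = q) (a : 𝒜 j) (b : 𝒜 l) :
    𝒜 q :=
  ⟨(a : R) * (b : R), h ▸ SetLike.mul_mem_graded a.2 b.2⟩

/-- A `ℤ`-graded right module `M = ⨁ M_i` over the graded `k`-algebra `R = ⨁ 𝒜_i`, given by its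
homogeneous components `M_i` and the actions `M_i × 𝒜_j → M_{i+j}`.  To avoid transports, the
action is indexed by `l` together with a proof of `i + j = l`. -/
structure GrMod {k : Type v} [CommRing k] {R : Type u} [Ring R] [Algebra k R]
    (𝒜 : ℤ → Submodule k R) [GradedAlgebra 𝒜] where
  comp : ℤ → Type u
  [addCommGroup : ∀ i, AddCommGroup (comp i)]
  [module : ∀ i, Module k (comp i)]
  act : ∀ {i j l : ℤ}, i + j = l → (comp i →ₗ[k] 𝒜 j →ₗ[k] comp l)
  act_one : ∀ {i : ℤ} (m : comp i), act (add_zero i) m ⟨1, SetLike.one_mem_graded 𝒜⟩ = m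
  act_act : ∀ {i j l p q r : ℤ} (hp : i + j = p) (hpl : p + l = r) (hq : j + l = q)
    (hiq : i + q = r) (m : comp i) (a : 𝒜 j) (b : 𝒜 l),
    act hpl (act hp m a) b = act hiq m (gradedMul 𝒜 hq a b)

namespace GrMod

attribute [instance] GrMod.addCommGroup GrMod.module

variable {k : Type v} [CommRing k] {R : Type u} [Ring R] [Algebra k R]
  {𝒜 : ℤ → Submodule k R} [GradedAlgebra 𝒜]

/-- Homomorphisms of graded modules that preserve degree. -/
@[ext]
structure Hom (M N : GrMod 𝒜) where
  app : ∀ i, M.comp i →ₗ[k] N.comp i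
  app_act : ∀ {i j l : ℤ} (h : i + j = l) (m : M.comp i) (a : 𝒜 j),
    app l (M.act h m a) = N.act h (app i m) a

/-- The category of graded right modules. -/
instance : Category.{u} (GrMod 𝒜) where
  Hom := Hom
  id M := ⟨fun _ => LinearMap.id, fun _ _ _ => rfl⟩
  comp f g := ⟨fun i => (g.app i).comp (f.app i), fun h m a => by
    simp [f.app_act h, g.app_act h]⟩

@[ext]
lemma hom_ext {M N : GrMod 𝒜} (f g : M ⟶ N) (h : ∀ i m, f.app i m = g.app i m) : f = g :=
  Hom.ext (funext fun i => LinearMap.ext (h i))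

@[simp]
lemma id_app (M : GrMod 𝒜) (i : ℤ) (m : M.comp i) : Hom.app (𝟙 M) i m = m := rfl

@[simp]
lemma comp_app {M N L : GrMod 𝒜} (f : M ⟶ N) (g : N ⟶ L) (i : ℤ) (m : M.comp i) :
    Hom.app (f ≫ g) i m = g.app i (f.app i m) := rfl

section HomModule

variable {M N : GrMod 𝒜}

instance : Zero (M ⟶ N) := ⟨⟨fun _ => 0, fun h m a => by simp⟩⟩

instance : Add (M ⟶ N) := ⟨fun f g => ⟨fun i => f.app i + g.app i, fun h m a => by
  simp [f.app_act h, g.app_act h]⟩⟩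

instance : Neg (M ⟶ N) := ⟨fun f => ⟨fun i => -f.app i, fun h m a => by
  simp [f.app_act h]⟩⟩

instance : SMul k (M ⟶ N) := ⟨fun c f => ⟨fun i => c • f.app i, fun h m a => by
  simp [f.app_act h]⟩⟩

@[simp]
lemma zero_app (i : ℤ) (m : M.comp i) : Hom.app (0 : M ⟶ N) i m = 0 := rfl

@[simp]
lemma add_app (f g : M ⟶ N) (i : ℤ) (m : M.comp i) :
    Hom.app (f + g) i m = f.app i m + g.app i m := rfl

@[simp]
lemma neg_app (f : M ⟶ N) (i : ℤ) (m : M.comp i) : Hom.app (-f) i m = -f.app i m := rfl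

@[simp]
lemma smul_app (c : k) (f : M ⟶ N) (i : ℤ) (m : M.comp i) :
    Hom.app (c • f) i m = c • f.app i m := rfl

instance : AddCommGroup (M ⟶ N) where
  add_assoc f g h := by ext i m; exact add_assoc _ _ _
  zero_add f := by ext i m; exact zero_add _
  add_zero f := by ext i m; exact add_zero _
  neg_add_cancel f := by ext i m; exact neg_add_cancel _
  add_comm f g := by ext i m; exact add_comm _ _
  nsmul := nsmulRec
  zsmul := zsmulRec

instance : Module k (M ⟶ N) where
  one_smul f := by ext i m; exact one_smul _ _
  mul_smul c d f := by ext i m; exact mul_smul _ _ _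
  smul_zero c := by ext i m; exact smul_zero _
  smul_add c f g := by ext i m; exact smul_add _ _ _
  add_smul c d f := by ext i m; exact add_smul _ _ _
  zero_smul f := by ext i m; exact zero_smul _ _

end HomModule

instance : Preadditive (GrMod 𝒜) where
  add_comp _ _ _ f f' g := by ext i m; simp
  comp_add _ _ _ f g g' := by ext i m; simp

instance : Linear k (GrMod 𝒜) where
  smul_comp _ _ _ c f g := by ext i m; simp
  comp_smul _ _ _ f c g := by ext i m; simp

/-- `M` is finitely generated: there are finitely many homogeneous elements `x_t`, of degrees
`d_t`, such that every homogeneous element is a combination `∑ x_t a_t`, `a_t` homogeneous. -/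
def FinitelyGenerated (M : GrMod 𝒜) : Prop :=
  ∃ (n : ℕ) (d : Fin n → ℤ) (x : ∀ t, M.comp (d t)),
    ∀ (i : ℤ) (m : M.comp i), ∃ a : ∀ t, 𝒜 (i - d t),
      m = ∑ t, M.act (add_sub_cancel (d t) i) (x t) (a t)

variable (𝒜) in
/-- The graded algebra as a right module over itself. -/
def regular : GrMod 𝒜 where
  comp i := 𝒜 i
  act h := LinearMap.mk₂ k (gradedMul 𝒜 h)
    (fun a b c => Subtype.ext (add_mul (a : R) b c))
    (fun c a b => Subtype.ext (smul_mul_assoc c (a : R) b))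
    (fun a b c => Subtype.ext (mul_add (a : R) b c))
    (fun c a b => Subtype.ext (mul_smul_comm c (a : R) b))
  act_one m := Subtype.ext (mul_one (m : R))
  act_act _ _ _ _ m a b := Subtype.ext (mul_assoc (m : R) a b)

/-- The shifted module `M⟨n⟩`, with `M⟨n⟩_j = M_{j-n}`. -/
def shiftObj (n : ℤ) (M : GrMod 𝒜) : GrMod 𝒜 where
  comp j := M.comp (j - n)
  act {i j l} h := M.act (show i - n + j = l - n by omega)
  act_one m := M.act_one m
  act_act _ _ hq _ m a b := M.act_act _ _ hq _ m a b

variable (𝒜) in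
/-- The functor `M ↦ M⟨n⟩`. -/
def shiftFunctor (n : ℤ) : GrMod 𝒜 ⥤ GrMod 𝒜 where
  obj := shiftObj n
  map f := ⟨fun i => f.app (i - n), fun _ m a => f.app_act _ m a⟩

/-- The identification `M_i = M_j` for `i = j` (action of `1 ∈ 𝒜_0`). -/
def compEquiv (M : GrMod 𝒜) {i j : ℤ} (h : i = j) : M.comp i ≃ₗ[k] M.comp j where
  toFun m := M.act (show i + 0 = j by omega) m ⟨1, SetLike.one_mem_graded 𝒜⟩
  map_add' x y := by simp
  map_smul' c x := by simp
  invFun m := M.act (show j + 0 = i by omega) m ⟨1, SetLike.one_mem_graded 𝒜⟩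
  left_inv m := by subst h; simp [M.act_one]
  right_inv m := by subst h; simp [M.act_one]

lemma app_compEquiv {M N : GrMod 𝒜} (f : M ⟶ N) {i j : ℤ} (h : i = j) (m : M.comp i) :
    f.app j (M.compEquiv h m) = N.compEquiv h (f.app i m) :=
  f.app_act _ m _

lemma compEquiv_act (M : GrMod 𝒜) {i i' j l l' : ℤ} (hi : i = i') (hl : l = l') (h : i + j = l)
    (h' : i' + j = l') (m : M.comp i) (a : 𝒜 j) :
    M.compEquiv hl (M.act h m a) = M.act h' (M.compEquiv hi m) a := by
  subst hi hl
  change M.act _ (M.act h m a) _ = M.act _ (M.act _ m _) a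
  rw [M.act_one, M.act_one]

/-- `M⟨n⟩⟨n'⟩ ≅ M` if `n + n' = 0`, naturally in `M`. -/
def shiftShiftIso (n n' : ℤ) (h : n + n' = 0) :
    shiftFunctor 𝒜 n ⋙ shiftFunctor 𝒜 n' ≅ 𝟭 (GrMod 𝒜) :=
  NatIso.ofComponents
    (fun M =>
      { hom := ⟨fun i => (M.compEquiv (show i - n' - n = i by omega)).toLinearMap,
          fun _ m a => M.compEquiv_act _ _ _ _ m a⟩
        inv := ⟨fun i => (M.compEquiv (show i - n' - n = i by omega)).symm.toLinearMap,
          fun _ m a => M.compEquiv_act (by omega) (by omega) _ _ m a⟩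
        hom_inv_id := by
          ext i m
          exact (M.compEquiv (show i - n' - n = i by omega)).symm_apply_apply m
        inv_hom_id := by
          ext i m
          exact (M.compEquiv (show i - n' - n = i by omega)).apply_symm_apply m })
    (fun f => by
      ext i m
      exact (app_compEquiv f (show i - n' - n = i by omega) m).symm)

variable (𝒜) in
/-- The shift functor `𝓢 : M ↦ M⟨1⟩`, `M⟨1⟩_j = M_{j-1}`, as an autoequivalence with
quasi-inverse `M ↦ M⟨-1⟩`. -/
def shift : GrMod 𝒜 ≌ GrMod 𝒜 :=
  CategoryTheory.Equivalence.mk (shiftFunctor 𝒜 1) (shiftFunctor 𝒜 (-1))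
    (shiftShiftIso 1 (-1) (by norm_num)).symm (shiftShiftIso (-1) 1 (by norm_num))

instance : (shift 𝒜).functor.Additive where
  map_add := rfl

instance : (shift 𝒜).functor.Linear k where
  map_smul _ _ := rfl

end GrMod

/-- Isomorphisms of graded algebras: algebra isomorphisms that preserve degree. -/
structure GradedAlgIso {k : Type v} [CommRing k] {S T : Type u} [Ring S] [Algebra k S] [Ring T]
    [Algebra k T] (𝒮 : ℤ → Submodule k S) (𝒯 : ℤ → Submodule k T) extends S ≃ₐ[k] T where
  map_mem : ∀ (n : ℤ) (s : S), s ∈ 𝒮 n → toFun s ∈ 𝒯 n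

/-- An isomorphism `σ : S → T` of graded algebras makes every graded `T`-module a graded
`S`-module, `m s = m σ(s)`. -/
def GradedAlgIso.restrict {k : Type v} [CommRing k] {S T : Type u} [Ring S] [Algebra k S] [Ring T]
    [Algebra k T] {𝒮 : ℤ → Submodule k S} {𝒯 : ℤ → Submodule k T} [GradedAlgebra 𝒮]
    [GradedAlgebra 𝒯] (σ : GradedAlgIso 𝒮 𝒯) : GrMod 𝒯 ⥤ GrMod 𝒮 where
  obj M :=
    { comp := M.comp
      act := fun {_ j _} h =>
        (M.act h).compl₂ (σ.toAlgEquiv.toLinearMap.restrict (σ.map_mem j))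
      act_one := fun m => by
        have : σ.toAlgEquiv.toLinearMap.restrict (σ.map_mem 0) ⟨1, SetLike.one_mem_graded 𝒮⟩ =
            ⟨1, SetLike.one_mem_graded 𝒯⟩ := Subtype.ext (map_one σ.toAlgEquiv)
        rw [LinearMap.compl₂_apply, this, M.act_one]
      act_act := fun hp hpl hq hiq m a b => by
        simp only [LinearMap.compl₂_apply]
        rw [M.act_act hp hpl hq hiq]
        congr 1
        exact Subtype.ext (map_mul σ.toAlgEquiv _ _).symm }
  map f := ⟨f.app, fun h m a => f.app_act h m _⟩

/-! ### Twisted endomorphism rings and twisted Hom functors -/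

namespace ZSequence

variable {C : Type w} [Category.{u} C] (𝓕 : ZSequence C) (P : C)

/-- The component of degree `n` of the twisted endomorphism ring: `hom(F_n P, P)`. -/
abbrev EndComp (n : ℤ) : Type u := (𝓕.functor n).obj P ⟶ P

/-- For `f : F_i P ⟶ N` and `b : F_j P ⟶ P`, the composite
`F_{i+j} P ⟶ F_i F_j P ⟶ F_i P ⟶ N` of `η^{ij}`, `F_i b` and `f`. -/
def twistedComp {P N : C} {i j l : ℤ} (h : i + j = l) (f : (𝓕.functor i).obj P ⟶ N)
    (b : (𝓕.functor j).obj P ⟶ P) : (𝓕.functor l).obj P ⟶ N :=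
  (𝓕.compat h).hom.app P ≫ (𝓕.functor i).map b ≫ f

variable {P}

lemma twistedComp_zero {N : C} {i : ℤ} (f : (𝓕.functor i).obj P ⟶ N) :
    𝓕.twistedComp (add_zero i) f (𝓕.zero.hom.app P) = f := by
  rw [twistedComp, ← Category.assoc, 𝓕.compat_zero_right, Category.id_comp]

lemma twistedComp_zero_left {i : ℤ} (f : (𝓕.functor i).obj P ⟶ P) :
    𝓕.twistedComp (zero_add i) (𝓕.zero.hom.app P) f = f := by
  have := 𝓕.zero.hom.naturality f
  simp only [Functor.id_map] at this
  rw [twistedComp, this, ← Category.assoc, 𝓕.compat_zero_left]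
  exact Category.id_comp _

lemma twistedComp_assoc {N : C} {i j l p q r : ℤ} (hp : i + j = p) (hpl : p + l = r)
    (hq : j + l = q) (hiq : i + q = r) (f : (𝓕.functor i).obj P ⟶ N)
    (a : (𝓕.functor j).obj P ⟶ P) (b : (𝓕.functor l).obj P ⟶ P) :
    𝓕.twistedComp hpl (𝓕.twistedComp hp f a) b =
      𝓕.twistedComp hiq f (𝓕.twistedComp hq a b) := by
  have n := (𝓕.compat hp).hom.naturality b
  simp only [Functor.comp_map] at n
  simp only [twistedComp, Functor.map_comp, Category.assoc]
  rw [reassoc_of% n, reassoc_of% (𝓕.compat_assoc hp hpl hq hiq P)]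

lemma twistedComp_postcomp {N N' : C} {i j l : ℤ} (h : i + j = l)
    (f : (𝓕.functor i).obj P ⟶ N) (b : (𝓕.functor j).obj P ⟶ P) (g : N ⟶ N') :
    𝓕.twistedComp h f b ≫ g = 𝓕.twistedComp h (f ≫ g) b := by
  simp [twistedComp]

section Ring

set_option linter.unusedSectionVars false

variable [Preadditive C] [∀ n, (𝓕.functor n).Additive]

lemma twistedComp_add {N : C} {i j l : ℤ} (h : i + j = l) (f : (𝓕.functor i).obj P ⟶ N)
    (b b' : (𝓕.functor j).obj P ⟶ P) :
    𝓕.twistedComp h f (b + b') = 𝓕.twistedComp h f b + 𝓕.twistedComp h f b' := by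
  simp [twistedComp, Functor.map_add]

lemma add_twistedComp {N : C} {i j l : ℤ} (h : i + j = l) (f f' : (𝓕.functor i).obj P ⟶ N)
    (b : (𝓕.functor j).obj P ⟶ P) :
    𝓕.twistedComp h (f + f') b = 𝓕.twistedComp h f b + 𝓕.twistedComp h f' b := by
  simp [twistedComp]

/-- The multiplication `hom(F_i P, P) × hom(F_j P, P) → hom(F_{i+j} P, P)`,
`a ⋆ b = a ∘ F_i(b) ∘ η^{ij}`. -/
instance : GradedMonoid.GMul (𝓕.EndComp P) := ⟨fun a b => 𝓕.twistedComp rfl a b⟩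

/-- The unit `F_0 P = P → P`. -/
instance : GradedMonoid.GOne (𝓕.EndComp P) := ⟨𝓕.zero.hom.app P⟩

instance : GRing (𝓕.EndComp P) where
  mul_zero a := by simp [GradedMonoid.GMul.mul, twistedComp]
  zero_mul b := by simp [GradedMonoid.GMul.mul, twistedComp]
  mul_add a b c := 𝓕.twistedComp_add rfl a b c
  add_mul a b c := 𝓕.add_twistedComp rfl a b c
  one_mul := by
    rintro ⟨i, a⟩
    have : ∀ (l : ℤ) (h : 0 + i = l),
        (⟨l, 𝓕.twistedComp h (𝓕.zero.hom.app P) a⟩ : GradedMonoid (𝓕.EndComp P)) = ⟨i, a⟩ := by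
      intro l h
      obtain rfl : i = l := by omega
      exact congrArg _ (𝓕.twistedComp_zero_left a)
    exact this _ rfl
  mul_one := by
    rintro ⟨i, a⟩
    have : ∀ (l : ℤ) (h : i + 0 = l),
        (⟨l, 𝓕.twistedComp h a (𝓕.zero.hom.app P)⟩ : GradedMonoid (𝓕.EndComp P)) = ⟨i, a⟩ := by
      intro l h
      obtain rfl : i = l := by omega
      exact congrArg _ (𝓕.twistedComp_zero a)
    exact this _ rfl
  mul_assoc := by
    rintro ⟨i, a⟩ ⟨j, b⟩ ⟨l, c⟩
    have : ∀ (r : ℤ) (h : i + (j + l) = r) (h' : i + j + l = r),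
        (⟨i + j + l, 𝓕.twistedComp rfl (𝓕.twistedComp rfl a b) c⟩ :
          GradedMonoid (𝓕.EndComp P)) = ⟨r, 𝓕.twistedComp h a (𝓕.twistedComp rfl b c)⟩ := by
      intro r h h'
      subst h'
      exact congrArg _ (𝓕.twistedComp_assoc rfl rfl rfl h a b c)
    exact this _ rfl (add_assoc i j l)
  natCast n := n • (𝓕.zero.hom.app P : (𝓕.functor 0).obj P ⟶ P)
  natCast_zero := zero_smul _ _
  natCast_succ n := succ_nsmul _ n
  intCast n := n • (𝓕.zero.hom.app P : (𝓕.functor 0).obj P ⟶ P)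
  intCast_ofNat n := natCast_zsmul _ n
  intCast_negSucc_ofNat n := negSucc_zsmul _ n

variable (k : Type v) [CommRing k] [Linear k C] [∀ n, (𝓕.functor n).Linear k]

lemma twistedComp_smul {N : C} {i j l : ℤ} (h : i + j = l) (c : k)
    (f : (𝓕.functor i).obj P ⟶ N) (b : (𝓕.functor j).obj P ⟶ P) :
    𝓕.twistedComp h f (c • b) = c • 𝓕.twistedComp h f b := by
  simp [twistedComp, Functor.map_smul]

lemma smul_twistedComp {N : C} {i j l : ℤ} (h : i + j = l) (c : k)
    (f : (𝓕.functor i).obj P ⟶ N) (b : (𝓕.functor j).obj P ⟶ P) :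
    𝓕.twistedComp h (c • f) b = c • 𝓕.twistedComp h f b := by
  simp [twistedComp]

lemma scalar_mul (c : k) {i l : ℤ} (h : 0 + i = l) (a : 𝓕.EndComp P i) :
    (⟨l, 𝓕.twistedComp h (c • 𝓕.zero.hom.app P) a⟩ : GradedMonoid (𝓕.EndComp P)) =
      ⟨i, c • a⟩ := by
  obtain rfl : i = l := by omega
  refine congrArg _ ?_
  rw [smul_twistedComp]
  exact congrArg (c • ·) (𝓕.twistedComp_zero_left a)

lemma mul_scalar (c : k) {i l : ℤ} (h : i + 0 = l) (a : 𝓕.EndComp P i) :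
    (⟨l, 𝓕.twistedComp h a (c • 𝓕.zero.hom.app P : (𝓕.functor 0).obj P ⟶ P)⟩ :
      GradedMonoid (𝓕.EndComp P)) = ⟨i, c • a⟩ := by
  obtain rfl : i = l := by omega
  refine congrArg _ ?_
  rw [twistedComp_smul]
  exact congrArg (c • ·) (𝓕.twistedComp_zero a)

instance : GAlgebra k (𝓕.EndComp P) where
  toFun :=
    { toFun := fun c => (c • 𝓕.zero.hom.app P : (𝓕.functor 0).obj P ⟶ P)
      map_zero' := zero_smul _ _
      map_add' := fun _ _ => add_smul _ _ _ }
  map_one := one_smul _ _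
  map_mul c d := by
    refine Eq.trans ?_ (𝓕.scalar_mul k c (i := 0) rfl
      (d • 𝓕.zero.hom.app P : (𝓕.functor 0).obj P ⟶ P)).symm
    exact congrArg _ (mul_smul c d _)
  commutes := by
    rintro c ⟨i, a⟩
    exact (𝓕.scalar_mul k c rfl a).trans (𝓕.mul_scalar k c rfl a).symm
  smul_def := by
    rintro c ⟨i, a⟩
    exact (𝓕.scalar_mul k c rfl a).symm

variable (P)

/-- The twisted endomorphism ring `⨁_n hom(F_n P, P)`. -/
abbrev TwistedEnd : Type u := ⨁ n, 𝓕.EndComp P n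

/-- The degree `n` component `hom(F_n P, P)` as a submodule of the twisted endomorphism ring. -/
def twistedEndGrading (n : ℤ) : Submodule k (𝓕.TwistedEnd P) :=
  LinearMap.range (DirectSum.lof k ℤ (𝓕.EndComp P) n)

instance : SetLike.GradedMonoid (𝓕.twistedEndGrading P k) where
  one_mem := ⟨𝓕.zero.hom.app P, rfl⟩
  mul_mem := by
    rintro i j _ _ ⟨a, rfl⟩ ⟨b, rfl⟩
    exact ⟨GradedMonoid.GMul.mul a b, (DirectSum.of_mul_of a b).symm⟩

noncomputable instance : GradedAlgebra (𝓕.twistedEndGrading P k) where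
  decompose' := DirectSum.toModule k ℤ _ (fun n =>
    (DirectSum.lof k ℤ (fun n => 𝓕.twistedEndGrading P k n) n).comp
      (DirectSum.lof k ℤ (𝓕.EndComp P) n).rangeRestrict)
  left_inv x := by
    induction x using DirectSum.induction_on with
    | zero => simp
    | of i a =>
      rw [← DirectSum.lof_eq_of k, DirectSum.toModule_lof]
      exact DirectSum.coeAddMonoidHom_of _ _ _
    | add x y hx hy => rw [map_add, map_add, hx, hy]
  right_inv x := by
    induction x using DirectSum.induction_on with
    | zero => simp
    | of i a =>
      obtain ⟨_, ⟨a, rfl⟩⟩ := a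
      rw [DirectSum.coeAddMonoidHom_of, DirectSum.toModule_lof]
      rfl
    | add x y hx hy => rw [map_add, map_add, hx, hy]

lemma mul_apply {j l q : ℤ} (h : j + l = q) {a b : 𝓕.TwistedEnd P}
    (ha : a ∈ 𝓕.twistedEndGrading P k j) (hb : b ∈ 𝓕.twistedEndGrading P k l) :
    (a * b) q = 𝓕.twistedComp h (a j) (b l) := by
  obtain ⟨a, rfl⟩ := ha
  obtain ⟨b, rfl⟩ := hb
  subst h
  rw [DirectSum.lof_eq_of, DirectSum.lof_eq_of, DirectSum.of_mul_of, DirectSum.of_eq_same,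
    DirectSum.of_eq_same, DirectSum.of_eq_same]
  rfl

/-- The twisted composition as a bilinear map. -/
def twistedCompLinear (N : C) {i j l : ℤ} (h : i + j = l) :
    ((𝓕.functor i).obj P ⟶ N) →ₗ[k] 𝓕.EndComp P j →ₗ[k] ((𝓕.functor l).obj P ⟶ N) :=
  LinearMap.mk₂ k (fun f b => 𝓕.twistedComp h f b)
    (fun f f' b => 𝓕.add_twistedComp h f f' b)
    (fun c f b => 𝓕.smul_twistedComp k h c f b)
    (fun f b b' => 𝓕.twistedComp_add h f b b')
    (fun c f b => 𝓕.twistedComp_smul k h c f b)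

/-- The twisted Hom functor `N ↦ ⨁_j hom(F_j P, N)`, a graded right module over the twisted
endomorphism ring via `f b = f ∘ F_j(b) ∘ η^{ji}` for `f : F_j P ⟶ N` and `b : F_i P ⟶ P`. -/
def twistedHom : C ⥤ GrMod (𝓕.twistedEndGrading P k) where
  obj N :=
    { comp := fun j => (𝓕.functor j).obj P ⟶ N
      act := fun {_ j _} h => (𝓕.twistedCompLinear P k N h).compl₂
        ((DirectSum.component k ℤ (𝓕.EndComp P) j).comp (𝓕.twistedEndGrading P k j).subtype)
      act_one := fun {i} m => by
        have : (1 : 𝓕.TwistedEnd P) 0 = 𝓕.zero.hom.app P := DirectSum.of_eq_same _ _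
        change 𝓕.twistedComp (add_zero i) m ((1 : 𝓕.TwistedEnd P) 0) = m
        rw [this]
        exact 𝓕.twistedComp_zero m
      act_act := fun {i j l p q r} hp hpl hq hiq m a b => by
        change 𝓕.twistedComp hpl (𝓕.twistedComp hp m ((a : 𝓕.TwistedEnd P) j))
            ((b : 𝓕.TwistedEnd P) l) =
          𝓕.twistedComp hiq m (((a : 𝓕.TwistedEnd P) * (b : 𝓕.TwistedEnd P)) q)
        rw [𝓕.twistedComp_assoc hp hpl hq hiq]
        rw [𝓕.mul_apply P k hq a.2 b.2] }
  map g := ⟨fun j => Linear.rightComp k _ g, fun h f b =>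
    𝓕.twistedComp_postcomp h f _ g⟩
  map_id N := by
    ext j f
    exact Category.comp_id f
  map_comp g g' := by
    ext j f
    exact (Category.assoc f g g').symm

end Ring

end ZSequence

/-! ### The notions attached to an autoequivalence -/

section Autoequivalence

variable {C : Type w} [Category.{w'} C] [Preadditive C] (F : C ≌ C) [F.functor.Additive]

lemma powNat_additive (G : C ≌ C) (hG : G.functor.Additive) :
    ∀ n, (G.powNat n).functor.Additive
  | 0 => inferInstanceAs (𝟭 C).Additive
  | 1 => hG
  | n + 2 =>
    have := powNat_additive G hG (n + 1)
    inferInstanceAs (G.functor ⋙ (G.powNat (n + 1)).functor).Additive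

instance ofEquivalence_additive : ∀ n, ((ZSequence.ofEquivalence F).functor n).Additive
  | Int.ofNat n => powNat_additive F inferInstance n
  | Int.negSucc n => powNat_additive F.symm (inferInstanceAs F.inverse.Additive) (n + 1)

variable (k : Type v) [CommRing k] [Linear k C] [F.functor.Linear k]

lemma powNat_linear (G : C ≌ C) (hG : G.functor.Linear k) :
    ∀ n, (G.powNat n).functor.Linear k
  | 0 => inferInstanceAs ((𝟭 C).Linear k)
  | 1 => hG
  | n + 2 =>
    have := powNat_linear G hG (n + 1)
    inferInstanceAs ((G.functor ⋙ (G.powNat (n + 1)).functor).Linear k)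

instance ofEquivalence_linear : ∀ n, ((ZSequence.ofEquivalence F).functor n).Linear k
  | Int.ofNat n => powNat_linear k F inferInstance n
  | Int.negSucc n => powNat_linear k F.symm (inferInstanceAs (F.inverse.Linear k)) (n + 1)

end Autoequivalence

section GradedEquivalence

variable {k : Type v} [CommRing k] {R : Type u} [Ring R] [Algebra k R]
  {𝒜 : ℤ → Submodule k R} [GradedAlgebra 𝒜] {S : Type u} [Ring S] [Algebra k S]
  {𝒮 : ℤ → Submodule k S} [GradedAlgebra 𝒮]

variable (𝒜 𝒮) in
/-- There is a `k`-linear equivalence between the categories of graded modules. -/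
def GradedEquivalent : Prop :=
  ∃ Φ : GrMod 𝒜 ≌ GrMod 𝒮, Φ.functor.Additive ∧ Φ.functor.Linear k

/-- `F` is `P`-generative: the modules `F^n P`, `n ∈ ℤ`, generate the category of graded
modules. -/
def IsGenerative (F : GrMod 𝒜 ≌ GrMod 𝒜) (P : GrMod 𝒜) : Prop :=
  (ObjectProperty.ofObj fun n : ℤ => (F ^ n).functor.obj P).IsSeparating

/-- The pullback `Φ^* G = Ψ G Φ` of an autoequivalence `G` along an equivalence `Φ` with
quasi-inverse `Ψ`. -/
def pullback (Φ : GrMod 𝒜 ≌ GrMod 𝒮) (G : GrMod 𝒮 ≌ GrMod 𝒮) : GrMod 𝒜 ≌ GrMod 𝒜 :=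
  (Φ.trans G).trans Φ.symm

lemma pullback_functor (Φ : GrMod 𝒜 ≌ GrMod 𝒮) (G : GrMod 𝒮 ≌ GrMod 𝒮) :
    (pullback Φ G).functor = (Φ.functor ⋙ G.functor) ⋙ Φ.inverse := rfl

instance (Φ : GrMod 𝒜 ≌ GrMod 𝒮) (G : GrMod 𝒮 ≌ GrMod 𝒮) [Φ.functor.Additive]
    [G.functor.Additive] : (pullback Φ G).functor.Additive :=
  inferInstanceAs ((Φ.functor ⋙ G.functor) ⋙ Φ.inverse).Additive

instance (Φ : GrMod 𝒜 ≌ GrMod 𝒮) (G : GrMod 𝒮 ≌ GrMod 𝒮) [Φ.functor.Additive]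
    [Φ.functor.Linear k] [G.functor.Linear k] : (pullback Φ G).functor.Linear k :=
  inferInstanceAs (((Φ.functor ⋙ G.functor) ⋙ Φ.inverse).Linear k)

variable (F : GrMod 𝒜 ≌ GrMod 𝒜) [F.functor.Additive] [F.functor.Linear k] (P : GrMod 𝒜)

/-- The grading of the `F`-twisted endomorphism ring `End^F(P) = ⨁_n hom(F^n P, P)`. -/
noncomputable abbrev endGrading :
    ℤ → Submodule k ((ZSequence.ofEquivalence F).TwistedEnd P) :=
  (ZSequence.ofEquivalence F).twistedEndGrading P k

/-- The `F`-twisted Hom functor `N ↦ ⨁_n hom(F^n P, N)`, from graded `R`-modules to graded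
modules over `End^F(P)`. -/
noncomputable abbrev twistedHomFunctor : GrMod 𝒜 ⥤ GrMod (endGrading F P) :=
  (ZSequence.ofEquivalence F).twistedHom P k

end GradedEquivalence

/-!
# Equivalences of categories of graded modules

The notion that carries both directions is that of a *compact projective* object
(`IsCompactProjective`): an object `Q` such that every morphism from `Q` into the sum of the
images of a family of morphisms is a finite sum of morphisms factoring through the family. It is
stated in terms of morphisms and zero tests only, so it passes along equivalences, and for graded
modules it means finitely generated and projective (`IsCompactProjective.finitelyGenerated`,
`IsCompactProjective.projective`, `GrMod.isCompactProjective_of_projective`).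

*From `(P, F)` to an equivalence.* All `F^n P` are compact projective and together they generate,
and for such a family the twisted Hom functor `H` is an equivalence
(`ZSequence.twistedHom_isEquivalence`). Its left adjoint sends a graded module `M` over the
twisted endomorphism ring to `M ⊗ P`, the coproduct of one copy of `F^j P` for each homogeneous `m
∈ M_j` modulo all morphisms `∑ ι_m b_m` from some `F^l P` with `∑ m b_m = 0` in `M`. Compactness
makes these sums finite and the value `∑ m b_m` well defined (`coverEval`); compact projectivity
shows that no further morphisms die in the quotient (`comp_tensorπ_eq_zero_iff`) and that all
morphisms into the quotient lift, so the unit `M ⟶ H (M ⊗ P)` is bijective. As the `F^n P`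
generate, `H` is faithful; it reflects monomorphisms and epimorphisms, so the counit is invertible
as well.

*From an equivalence `Φ` to `(P, F)`.* Let `Ψ` be the quasi-inverse, `F = Ψ 𝓢 Φ` and `P = Ψ S`.
The counit gives `Φ F ≅ 𝓢 Φ`, hence `Φ F^n ≅ 𝓢^n Φ` for all integers `n`, and these isomorphisms
turn `F^{i+j} ≅ F^i F^j` into the identification `M⟨i+j⟩ = M⟨j⟩⟨i⟩` (`powPullback_add`): both
sides satisfy the same recursion in `j`. In particular `Φ (F^n P) ≅ S⟨n⟩` is free on one generator
of degree `n`, and evaluation at it gives bijections `hom(F^n P, N) ≅ (Φ N)_n` (`pullbackEval`),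
which turn twisted composition into the action of `S` (`pullbackEval_twistedComp`). For `N = P`
this is the isomorphism of `S` with the twisted endomorphism ring, and for general `N` it is the
isomorphism of `Φ` with the twisted Hom functor. The evaluations are natural and surjective, so a
morphism `N ⟶ N'` is determined by its composites with the morphisms `F^n P ⟶ N`, that is, the
`F^n P` generate; and `P` is compact projective because the regular module `S`, free on one
generator, is.
-/

/-! ### Compact projective objects -/

section CompactProjective

variable {C : Type w} [Category.{w'} C] [Preadditive C]

/-- `Q` is compact projective (relative to families indexed by types in universe `u`): whenever
`h : Q ⟶ N` vanishes on every object on which the family `r s : X s ⟶ N` vanishes (that is, the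
image of `h` lies in the sum of the images of the `r s`), `h` is a finite sum of morphisms that
factor through members of the family. This form needs neither coproducts nor images, so that it
passes along equivalences. -/
def IsCompactProjective (Q : C) : Prop :=
  ∀ (ι : Type u) (X : ι → C) (N : C) (r : ∀ s, X s ⟶ N) (h : Q ⟶ N),
    (∀ (L : C) (t : N ⟶ L), (∀ s, r s ≫ t = 0) → h ≫ t = 0) →
      h ∈ AddSubgroup.closure {f : Q ⟶ N | ∃ s, ∃ g : Q ⟶ X s, g ≫ r s = f}

/-- The finite sums of morphisms factoring through a family are stable under precomposition. -/
lemma precomp_mem_closure {ι : Type u} {X : ι → C} {N Q Q' : C} {r : ∀ s, X s ⟶ N} {f : Q ⟶ N}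
    (g : Q' ⟶ Q)
    (hf : f ∈ AddSubgroup.closure {f : Q ⟶ N | ∃ s, ∃ g : Q ⟶ X s, g ≫ r s = f}) :
    g ≫ f ∈ AddSubgroup.closure {f : Q' ⟶ N | ∃ s, ∃ g : Q' ⟶ X s, g ≫ r s = f} := by
  have : AddSubgroup.closure {f : Q ⟶ N | ∃ s, ∃ g : Q ⟶ X s, g ≫ r s = f} ≤
      (AddSubgroup.closure {f : Q' ⟶ N | ∃ s, ∃ g : Q' ⟶ X s, g ≫ r s = f}).comap
        (Preadditive.leftComp N g) := by
    rw [AddSubgroup.closure_le]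
    rintro _ ⟨s, g', rfl⟩
    exact AddSubgroup.subset_closure ⟨s, g ≫ g', Category.assoc _ _ _⟩
  exact this hf

namespace IsCompactProjective

lemma of_equivalence {D : Type*} [Category* D] [Preadditive D] (E : C ≌ D)
    [E.functor.Additive] {Q : C} (hQ : IsCompactProjective.{u} Q) :
    IsCompactProjective.{u} (E.functor.obj Q) := by
  intro ι X N r h H
  let T : (Q ⟶ E.inverse.obj N) →+ (E.functor.obj Q ⟶ N) :=
    (Preadditive.rightComp _ (E.counit.app N)).comp E.functor.mapAddHom
  have hT : ∀ f, T f = E.functor.map f ≫ E.counit.app N := fun f => rfl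
  have key := hQ ι (fun s => E.inverse.obj (X s)) (E.inverse.obj N)
    (fun s => E.inverse.map (r s)) (E.unit.app Q ≫ E.inverse.map h) (by
      intro L t ht
      have h1 := H _ (E.counitInv.app N ≫ E.functor.map t) (by
        intro s
        have n : r s ≫ E.counitInv.app N = _ := E.counitInv.naturality (r s)
        rw [reassoc_of% n]
        have := congrArg E.functor.map (ht s)
        rw [Functor.map_comp, Functor.map_zero] at this
        erw [this, Limits.comp_zero])
      apply E.functor.map_injective
      have n : h ≫ E.counitInv.app N = _ := E.counitInv.naturality h
      rw [reassoc_of% n] at h1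
      rw [Category.assoc, Functor.map_comp, Functor.map_comp, Functor.map_zero, ← h1,
        ← E.counitInv_app_functor])
  have hle : AddSubgroup.closure
      {f | ∃ s, ∃ g : Q ⟶ E.inverse.obj (X s), g ≫ E.inverse.map (r s) = f} ≤
      (AddSubgroup.closure {f | ∃ s, ∃ g : E.functor.obj Q ⟶ X s, g ≫ r s = f}).comap T := by
    rw [AddSubgroup.closure_le]
    rintro _ ⟨s, g, rfl⟩
    refine AddSubgroup.subset_closure ⟨s, E.functor.map g ≫ E.counit.app _, ?_⟩
    have n : E.functor.map (E.inverse.map (r s)) ≫ E.counit.app _ = _ :=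
      E.counit.naturality (r s)
    rw [hT, Functor.map_comp, Category.assoc, Category.assoc, n]
    rfl
  have hh : T (E.unit.app Q ≫ E.inverse.map h) = h := by
    have n : E.functor.map (E.inverse.map h) ≫ E.counit.app _ = _ := E.counit.naturality h
    rw [hT, Functor.map_comp, Category.assoc, n]
    exact E.functor_unit_comp_assoc Q h
  rw [← hh]
  exact hle key

lemma projective {Q : C} (hQ : IsCompactProjective.{u} Q) : Projective Q where
  factors {E X} f e _ := by
    have h := hQ PUnit (fun _ => E) X (fun _ => e) f (fun L t ht => by
      rw [(cancel_epi e).1 ((ht ⟨⟩).trans Limits.comp_zero.symm), Limits.comp_zero])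
    have hle : AddSubgroup.closure {f : Q ⟶ X | ∃ _ : PUnit, ∃ g : Q ⟶ E, g ≫ e = f} ≤
        (Preadditive.rightComp Q e).range := by
      rw [AddSubgroup.closure_le]
      rintro _ ⟨_, g, rfl⟩
      exact ⟨g, rfl⟩
    exact hle h

/-- A retract of a finite direct sum of compact projective objects is compact projective. -/
lemma of_retract {J : Type} [Fintype J] {X : J → C} [Limits.HasBiproduct X] {Q : C}
    (hX : ∀ j, IsCompactProjective.{u} (X j)) (s : Q ⟶ ⨁ X) (p : ⨁ X ⟶ Q) (hsp : s ≫ p = 𝟙 Q) :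
    IsCompactProjective.{u} Q := by
  intro ι Y N r h H
  have : h = ∑ j, (s ≫ Limits.biproduct.π X j) ≫ Limits.biproduct.ι X j ≫ p ≫ h := by
    calc h = s ≫ (∑ j, Limits.biproduct.π X j ≫ Limits.biproduct.ι X j) ≫ p ≫ h := by
          rw [Limits.biproduct.total, Category.id_comp, reassoc_of% hsp]
      _ = _ := by simp only [Preadditive.sum_comp, Preadditive.comp_sum, Category.assoc]
  rw [this]
  refine AddSubgroup.sum_mem _ fun j _ => precomp_mem_closure _ (hX j ι Y N r _ fun L t ht => ?_)
  simp [H L t ht]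

end IsCompactProjective

end CompactProjective

/-! ### Quotients, coproducts and cokernels of graded modules -/

namespace GrMod

variable {k : Type v} [CommRing k] {R : Type u} [Ring R] [Algebra k R]
  {𝒜 : ℤ → Submodule k R} [GradedAlgebra 𝒜]

section Quotient

variable (M : GrMod 𝒜) (W : ∀ i, Submodule k (M.comp i))
  (hW : ∀ {i j l : ℤ} (h : i + j = l) (m : M.comp i) (a : 𝒜 j), m ∈ W i → M.act h m a ∈ W l)

/-- The quotient of a graded module by a graded submodule, given by its components `W i`. -/
def quotient : GrMod 𝒜 where
  comp i := M.comp i ⧸ W i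
  act {i j l} h := (W i).liftQ ((M.act h).compr₂ (W l).mkQ) (fun m hm => by
    ext a
    exact (Submodule.Quotient.mk_eq_zero _).2 (hW h m a hm))
  act_one m := by
    induction m using Submodule.Quotient.induction_on with
    | H m => exact congrArg _ (M.act_one m)
  act_act hp hpl hq hiq m a b := by
    induction m using Submodule.Quotient.induction_on with
    | H m => exact congrArg _ (M.act_act hp hpl hq hiq m a b)

/-- The projection to the quotient. -/
def toQuotient : M ⟶ M.quotient W hW where
  app i := (W i).mkQ
  app_act _ _ _ := rfl

variable {M W} in
/-- The morphism from the quotient induced by a morphism that vanishes on the submodule. -/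
def quotientDesc {N : GrMod 𝒜} (f : M ⟶ N) (hf : ∀ i, W i ≤ LinearMap.ker (f.app i)) :
    M.quotient W hW ⟶ N where
  app i := (W i).liftQ (f.app i) (hf i)
  app_act h m a := by
    induction m using Submodule.Quotient.induction_on with
    | H m => exact f.app_act h m a

end Quotient

lemma act_mem_iSup_range {ι : Type*} {X : ι → GrMod 𝒜} {N : GrMod 𝒜} (r : ∀ s, X s ⟶ N)
    {i j l : ℤ} (h : i + j = l) (m : N.comp i) (a : 𝒜 j)
    (hm : m ∈ ⨆ s, LinearMap.range ((r s).app i)) :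
    N.act h m a ∈ ⨆ s, LinearMap.range ((r s).app l) := by
  have hle : (⨆ s, LinearMap.range ((r s).app i)) ≤
      (⨆ s, LinearMap.range ((r s).app l)).comap ((N.act h).flip a) := by
    refine iSup_le fun s => ?_
    rintro _ ⟨x, rfl⟩
    exact Submodule.mem_iSup_of_mem s ⟨(X s).act h x a, (r s).app_act h x a⟩
  exact hle hm

/-- An element killed by every morphism that kills the family `r` lies in the sum of the images
of `r`. -/
lemma mem_iSup_range {ι : Type*} {X : ι → GrMod 𝒜} {N : GrMod 𝒜} (r : ∀ s, X s ⟶ N)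
    {i : ℤ} (m : N.comp i)
    (H : ∀ (L : GrMod 𝒜) (t : N ⟶ L), (∀ s, r s ≫ t = 0) → t.app i m = 0) :
    m ∈ ⨆ s, LinearMap.range ((r s).app i) := by
  refine (Submodule.Quotient.mk_eq_zero _).1 (H (N.quotient
    (fun i => ⨆ s, LinearMap.range ((r s).app i)) (act_mem_iSup_range r))
    (N.toQuotient _ (act_mem_iSup_range r)) fun s => ?_)
  ext i x
  exact (Submodule.Quotient.mk_eq_zero _).2 (Submodule.mem_iSup_of_mem s ⟨x, rfl⟩)

lemma surjective_of_epi {M N : GrMod 𝒜} (f : M ⟶ N) [Epi f] (i : ℤ) :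
    Function.Surjective (f.app i) := by
  intro m
  have := mem_iSup_range (fun _ : Unit => f) m (fun L t ht => by
    rw [(cancel_epi f).1 ((ht ⟨⟩).trans Limits.comp_zero.symm)]; rfl)
  rw [iSup_unique] at this
  exact this

/-- A bijective homomorphism of graded modules as an isomorphism. -/
noncomputable def isoOfBijective {M N : GrMod 𝒜} (f : M ⟶ N)
    (hf : ∀ i, Function.Bijective (f.app i)) : M ≅ N where
  hom := f
  inv :=
    { app := fun i => (LinearEquiv.ofBijective (f.app i) (hf i)).symm.toLinearMap
      app_act := fun {i j l} h m a => by
        apply (hf l).1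
        have e : ∀ i m, f.app i ((LinearEquiv.ofBijective (f.app i) (hf i)).symm m) = m :=
          fun i => (LinearEquiv.ofBijective (f.app i) (hf i)).apply_symm_apply
        simp only [LinearEquiv.coe_coe]
        rw [e, f.app_act, e] }
  hom_inv_id := by
    ext i m
    exact (LinearEquiv.ofBijective (f.app i) (hf i)).symm_apply_apply m
  inv_hom_id := by
    ext i m
    exact (LinearEquiv.ofBijective (f.app i) (hf i)).apply_symm_apply m

lemma isIso_of_bijective {M N : GrMod 𝒜} (f : M ⟶ N)
    (hf : ∀ i, Function.Bijective (f.app i)) : IsIso f :=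
  (isoOfBijective f hf).isIso_hom

lemma bijective_of_iso {M N : GrMod 𝒜} (e : M ≅ N) (i : ℤ) :
    Function.Bijective (e.hom.app i) :=
  Function.bijective_iff_has_inverse.2 ⟨e.inv.app i,
    fun m => congrArg (fun f => Hom.app f i m) e.hom_inv_id,
    fun m => congrArg (fun f => Hom.app f i m) e.inv_hom_id⟩

section Coproduct

open Classical in
/-- The direct sum of a family of graded modules. -/
noncomputable def directSum {ι : Type u} (X : ι → GrMod 𝒜) : GrMod 𝒜 where
  comp i := ⨁ s, (X s).comp i
  act {i j l} h := DirectSum.toModule k ι _ fun s =>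
    ((X s).act h).compr₂ (DirectSum.lof k ι (fun s => (X s).comp l) s)
  act_one {i} m := by
    induction m using DirectSum.induction_on with
    | zero => simp
    | of s x =>
      rw [← DirectSum.lof_eq_of k, DirectSum.toModule_lof, LinearMap.compr₂_apply, (X s).act_one]
    | add x y hx hy => rw [map_add, LinearMap.add_apply, hx, hy]
  act_act {i j l p q r} hp hpl hq hiq m a b := by
    induction m using DirectSum.induction_on with
    | zero => simp
    | of s x =>
      rw [← DirectSum.lof_eq_of k, DirectSum.toModule_lof, LinearMap.compr₂_apply,
        DirectSum.toModule_lof, LinearMap.compr₂_apply, DirectSum.toModule_lof,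
        LinearMap.compr₂_apply, (X s).act_act hp hpl hq hiq]
    | add x y hx hy =>
      simp only [map_add, LinearMap.add_apply, hx, hy]

open Classical in
/-- The inclusion of a summand. -/
noncomputable def directSumι {ι : Type u} (X : ι → GrMod 𝒜) (s : ι) : X s ⟶ directSum X where
  app i := DirectSum.lof k ι (fun s => (X s).comp i) s
  app_act h m a := by
    exact (LinearMap.congr_fun (DirectSum.toModule_lof k (φ := fun s =>
      ((X s).act h).compr₂ (DirectSum.lof k ι (fun s => (X s).comp _) s)) s m) a).symm

open Classical in
/-- The morphism from the direct sum with the given components. -/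
noncomputable def directSumDesc {ι : Type u} {X : ι → GrMod 𝒜} {N : GrMod 𝒜}
    (f : ∀ s, X s ⟶ N) : directSum X ⟶ N where
  app i := DirectSum.toModule k ι _ fun s => (f s).app i
  app_act {i j l} h m a := by
    change DirectSum.toModule k ι (N.comp l) _
        (DirectSum.toModule k ι (𝒜 j →ₗ[k] ⨁ s, (X s).comp l) _ m a) =
      N.act h (DirectSum.toModule k ι (N.comp i) _ m) a
    induction m using DirectSum.induction_on with
    | zero => simp
    | of s x =>
      rw [← DirectSum.lof_eq_of k, DirectSum.toModule_lof, LinearMap.compr₂_apply,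
        DirectSum.toModule_lof, DirectSum.toModule_lof, (f s).app_act]
    | add x y hx hy => simp only [map_add, LinearMap.add_apply, hx, hy]

open Classical in
instance : Limits.HasCoproducts.{u} (GrMod 𝒜) :=
  Limits.hasCoproducts_of_colimit_cofans
    (fun X => Limits.Cofan.mk (directSum X) (directSumι X))
    (fun X => Limits.Cofan.IsColimit.mk _ (fun c => directSumDesc c.inj)
      (fun c s => by
        ext i m
        exact DirectSum.toModule_lof k (φ := fun t => (c.inj t).app i) s m)
      (fun c f hf => by
        refine GrMod.Hom.ext (funext fun i => DirectSum.linearMap_ext k fun s => ?_)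
        ext m
        refine Eq.trans ?_
          (DirectSum.toModule_lof k (φ := fun t => (c.inj t).app i) s m).symm
        exact congrArg (fun g => Hom.app g i m) (hf s)))

end Coproduct

instance : Limits.HasCokernels (GrMod 𝒜) where
  has_colimit {M N} f := by
    have hW : ∀ {i j l : ℤ} (h : i + j = l) (m : N.comp i) (a : 𝒜 j),
        m ∈ LinearMap.range (f.app i) → N.act h m a ∈ LinearMap.range (f.app l) := by
      rintro i j l h _ a ⟨m, rfl⟩
      exact ⟨M.act h m a, f.app_act h m a⟩
    refine ⟨⟨Limits.CokernelCofork.ofπ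
      (N.toQuotient (fun i => LinearMap.range (f.app i)) hW) ?_,
      Limits.CokernelCofork.IsColimit.ofπ _ _ (fun g hg => quotientDesc hW g ?_) ?_ ?_⟩⟩
    · ext i m
      exact (Submodule.Quotient.mk_eq_zero _).2 ⟨m, rfl⟩
    · rintro i _ ⟨m, rfl⟩
      exact congrArg (fun g => Hom.app g i m) hg
    · intro Z g hg
      rfl
    · intro Z g hg t ht
      ext i m
      induction m using Submodule.Quotient.induction_on with
      | H m => exact congrArg (fun g => Hom.app g i m) ht

/-! ### Free modules on one homogeneous generator -/

/-- The homogeneous element `e` of degree `d` freely generates `Q`. -/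
def IsFreeOn (Q : GrMod 𝒜) {d : ℤ} (e : Q.comp d) : Prop :=
  ∀ ⦃j l : ℤ⦄ (h : d + j = l), Function.Bijective (Q.act h e)

variable (𝒜) in
/-- The unit of the graded algebra, as an element of degree `0` of the regular module. -/
def regularOne : (regular 𝒜).comp 0 := ⟨1, SetLike.one_mem_graded 𝒜⟩

lemma regularOne_act {j : ℤ} (h : 0 + j = j) (a : 𝒜 j) :
    (regular 𝒜).act h (regularOne 𝒜) a = a :=
  Subtype.ext (one_mul (a : R))

lemma isFreeOn_regularOne : (regular 𝒜).IsFreeOn (regularOne 𝒜) := by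
  intro j l h
  obtain rfl : j = l := by omega
  have : ⇑((regular 𝒜).act h (regularOne 𝒜)) = id := funext (regularOne_act h)
  rw [this]
  exact Function.bijective_id

lemma act_compEquiv (M : GrMod 𝒜) {i i' j l : ℤ} (hi : i = i') (h : i' + j = l) (m : M.comp i)
    (a : 𝒜 j) : M.act h (M.compEquiv hi m) a = M.act (hi ▸ h) m a := by
  subst hi
  exact congrArg (fun x => M.act h x a) (M.act_one m)

namespace IsFreeOn

variable {Q : GrMod 𝒜} {d : ℤ} {e : Q.comp d}

lemma of_iso (he : Q.IsFreeOn e) {Q' : GrMod 𝒜} (f : Q ≅ Q') : Q'.IsFreeOn (f.hom.app d e) := by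
  intro j l h
  have : ⇑(Q'.act h (f.hom.app d e)) = f.hom.app l ∘ Q.act h e :=
    funext fun a => (f.hom.app_act h e a).symm
  rw [this]
  exact (bijective_of_iso f l).comp (he h)

lemma shift (he : Q.IsFreeOn e) (n d' : ℤ) (hd : d = d' - n) :
    (shiftObj n Q).IsFreeOn (d := d') (Q.compEquiv hd e) := by
  intro j l h
  have : ⇑((shiftObj n Q).act h (Q.compEquiv hd e)) = Q.act (show d + j = l - n by omega) e :=
    funext fun a => Q.act_compEquiv hd _ e a
  rw [this]
  exact he _

/-- Homomorphisms out of a free module are determined by the image of the generator, which may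
be any homogeneous element of the same degree. -/
lemma bijective_eval (he : Q.IsFreeOn e) (M : GrMod 𝒜) :
    Function.Bijective (fun f : Q ⟶ M => f.app d e) := by
  refine ⟨fun f g hfg => ?_, fun m => ?_⟩
  · ext i q
    obtain ⟨a, rfl⟩ := (he (add_sub_cancel d i)).2 q
    rw [f.app_act, g.app_act]
    exact congrArg (fun x => M.act _ x a) hfg
  · let E : ∀ i, 𝒜 (i - d) ≃ₗ[k] Q.comp i := fun i =>
      LinearEquiv.ofBijective (Q.act (add_sub_cancel d i) e) (he _)
    have hE : ∀ i a, (E i).symm (Q.act (add_sub_cancel d i) e a) = a :=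
      fun i a => (E i).symm_apply_apply a
    refine ⟨⟨fun i => (M.act (add_sub_cancel d i) m).comp (E i).symm.toLinearMap, ?_⟩, ?_⟩
    · intro i j l h q a
      obtain ⟨b, rfl⟩ := (he (add_sub_cancel d i)).2 q
      rw [Q.act_act (add_sub_cancel d i) h (show i - d + j = l - d by omega)
        (add_sub_cancel d l)]
      simp only [LinearMap.comp_apply, LinearEquiv.coe_coe, hE]
      rw [M.act_act]
    · -- the coefficient of `e` lies in degree `d - d`, which is only propositionally `0`
      have key : ∀ (z : ℤ) (hz : z = 0) (h : d + z = d) (a : 𝒜 z),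
          Q.act h e a = e → M.act h m a = m := by
        intro z hz h a ha
        subst hz
        have : a = ⟨1, SetLike.one_mem_graded 𝒜⟩ :=
          (he h).1 (ha.trans (Q.act_one e).symm)
        rw [this, M.act_one]
      exact key _ (sub_self d) _ _ ((E d).apply_symm_apply e)

lemma isCompactProjective (he : Q.IsFreeOn e) : IsCompactProjective.{u} Q := by
  intro ι X N r h H
  have hm := mem_iSup_range r (h.app d e) (fun L t ht =>
    congrArg (fun g => Hom.app g d e) (H L t ht))
  have hle : (⨆ s, LinearMap.range ((r s).app d)) ≤
      { AddSubgroup.map (AddMonoidHom.mk' (fun f : Q ⟶ N => f.app d e) (fun _ _ => rfl))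
          (AddSubgroup.closure {f : Q ⟶ N | ∃ s, ∃ g : Q ⟶ X s, g ≫ r s = f}) with
        smul_mem' := fun c x hx => by
          obtain ⟨f, hf, rfl⟩ := hx
          refine ⟨c • f, ?_, rfl⟩
          simpa using precomp_mem_closure (c • 𝟙 Q) hf } := by
    refine iSup_le fun s => ?_
    rintro _ ⟨x, rfl⟩
    obtain ⟨g, rfl⟩ := (he.bijective_eval (X s)).2 x
    exact ⟨g ≫ r s, AddSubgroup.subset_closure ⟨s, g, rfl⟩, rfl⟩
  obtain ⟨f, hf, hfe⟩ := hle hm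
  rwa [← (he.bijective_eval N).1 hfe]

end IsFreeOn

variable (𝒜) in
lemma exists_isFreeOn (d : ℤ) : ∃ e, (shiftObj d (regular 𝒜)).IsFreeOn (d := d) e :=
  ⟨_, isFreeOn_regularOne.shift d d (sub_self d).symm⟩

instance : Balanced (GrMod 𝒜) where
  isIso_of_mono_of_epi {M N} f _ _ := by
    refine isIso_of_bijective f fun i => ⟨fun x y hxy => ?_, surjective_of_epi f i⟩
    obtain ⟨e, he⟩ := exists_isFreeOn 𝒜 i
    obtain ⟨g, rfl⟩ := (he.bijective_eval M).2 x
    obtain ⟨g', rfl⟩ := (he.bijective_eval M).2 y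
    have : g ≫ f = g' ≫ f := (he.bijective_eval N).1 hxy
    rw [(cancel_mono f).1 this]

/-! ### Finitely generated projective modules are the compact projective objects -/

/-- The form of finite generation that is stable under unions of generating sets. -/
lemma finitelyGenerated_of_finset {M : GrMod 𝒜} (s : Finset (Σ d, M.comp d))
    (hs : ∀ i (m : M.comp i),
      m ∈ ⨆ x ∈ s, LinearMap.range (M.act (add_sub_cancel x.1 i) x.2)) :
    M.FinitelyGenerated := by
  refine ⟨s.card, fun t => (s.equivFin.symm t).1.1, fun t => (s.equivFin.symm t).1.2,
    fun i m => ?_⟩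
  have hm := hs i m
  rw [Submodule.mem_iSup_finset_iff_exists_sum] at hm
  obtain ⟨μ, hμ⟩ := hm
  choose a ha using fun x => (μ x).2
  refine ⟨fun t => a (s.equivFin.symm t).1, ?_⟩
  simp only [ha]
  rw [← hμ, ← Finset.sum_coe_sort s]
  exact (s.equivFin.symm.sum_comp (fun x => (μ x.1 : M.comp i))).symm

lemma _root_.IsCompactProjective.finitelyGenerated {M : GrMod 𝒜}
    (hM : IsCompactProjective.{u} M) : M.FinitelyGenerated := by
  classical
  choose e he using exists_isFreeOn 𝒜
  choose r hr using fun x : Σ d, M.comp d => ((he x.1).bijective_eval M).2 x.2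
  have h1 := hM _ _ M r (𝟙 M) (fun L t ht => by
    ext i m
    have := congrArg (fun g => Hom.app g i (e i)) (ht ⟨i, m⟩)
    simpa [hr ⟨i, m⟩] using this)
  let G : AddSubgroup (M ⟶ M) :=
    { carrier := {f | ∃ s : Finset (Σ d, M.comp d), ∀ i m,
        f.app i m ∈ ⨆ x ∈ s, LinearMap.range (M.act (add_sub_cancel x.1 i) x.2)}
      zero_mem' := ⟨∅, fun i m => Submodule.zero_mem _⟩
      add_mem' := by
        rintro f g ⟨s, hs⟩ ⟨t, ht⟩
        refine ⟨s ∪ t, fun i m => Submodule.add_mem _ ?_ ?_⟩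
        · exact SetLike.le_def.1 (biSup_mono fun x hx => Finset.mem_union_left t hx) (hs i m)
        · exact SetLike.le_def.1 (biSup_mono fun x hx => Finset.mem_union_right s hx) (ht i m)
      neg_mem' := by
        rintro f ⟨s, hs⟩
        exact ⟨s, fun i m => Submodule.neg_mem _ (hs i m)⟩ }
  have hle : AddSubgroup.closure {f | ∃ x, ∃ g : M ⟶ _, g ≫ r x = f} ≤ G := by
    rw [AddSubgroup.closure_le]
    rintro _ ⟨x, g, rfl⟩
    refine ⟨{x}, fun i m => ?_⟩
    obtain ⟨a, ha⟩ := (he x.1 (add_sub_cancel x.1 i)).2 (g.app i m)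
    refine Submodule.mem_iSup_of_mem x
      (Submodule.mem_iSup_of_mem (Finset.mem_singleton_self x) ⟨a, ?_⟩)
    rw [comp_app, ← ha, (r x).app_act]
    exact congrArg (fun y => M.act _ y a) (hr x).symm
  obtain ⟨s, hs⟩ := hle h1
  exact finitelyGenerated_of_finset s hs

lemma isCompactProjective_of_projective {P : GrMod 𝒜} (hP : P.FinitelyGenerated)
    [Projective P] : IsCompactProjective.{u} P := by
  have := Limits.hasFiniteCoproducts_of_hasCoproducts.{u} (GrMod 𝒜)
  have := Limits.HasFiniteBiproducts.of_hasFiniteCoproducts (C := GrMod 𝒜)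
  obtain ⟨n, d, x, hx⟩ := hP
  choose e he using exists_isFreeOn 𝒜
  choose r hr using fun t => ((he (d t)).bijective_eval P).2 (x t)
  -- the finite free cover given by the generators; it splits as `P` is projective
  let p := Limits.biproduct.desc r
  have : Epi p := by
    refine Preadditive.epi_of_cancel_zero _ fun {L} g hg => ?_
    have h0 : ∀ t, g.app (d t) (x t) = 0 := fun t => by
      have : r t ≫ g = 0 := by
        rw [← Limits.biproduct.ι_desc r t, Category.assoc, hg, Limits.comp_zero]
      rw [← hr t]
      exact congrArg (fun g => Hom.app g (d t) (e (d t))) this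
    ext i m
    obtain ⟨a, rfl⟩ := hx i m
    rw [map_sum]
    refine Finset.sum_eq_zero fun t _ => ?_
    rw [g.app_act, h0, map_zero, LinearMap.zero_apply]
  exact IsCompactProjective.of_retract (fun t => (he (d t)).isCompactProjective)
    (Projective.factorThru (𝟙 P) p) p (Projective.factorThru_comp _ _)

end GrMod

/-! ### Twisted Hom functors of compact projective generators -/

namespace ZSequence

set_option linter.unusedSectionVars false

variable {C : Type w} [Category.{u} C] (𝓕 : ZSequence C) {P : C}

lemma id_twistedComp {i j l : ℤ} (h : i + j = l) (b : 𝓕.EndComp P j) {N : C}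
    (f : (𝓕.functor i).obj P ⟶ N) :
    𝓕.twistedComp h (𝟙 _) b ≫ f = 𝓕.twistedComp h f b := by
  simp [twistedComp]

variable [Preadditive C] [∀ n, (𝓕.functor n).Additive] {k : Type v} [CommRing k] [Linear k C]
  [∀ n, (𝓕.functor n).Linear k]

variable (k) in
/-- A morphism `F_i P ⟶ P` as a homogeneous element of the twisted endomorphism ring. -/
def homogeneous (i : ℤ) : 𝓕.EndComp P i →ₗ[k] 𝓕.twistedEndGrading P k i :=
  (DirectSum.lof k ℤ (𝓕.EndComp P) i).rangeRestrict

lemma homogeneous_apply (i : ℤ) (a : 𝓕.twistedEndGrading P k i) :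
    𝓕.homogeneous k i ((a : 𝓕.TwistedEnd P) i) = a := by
  obtain ⟨_, ⟨a, rfl⟩⟩ := a
  refine Subtype.ext ?_
  change DirectSum.of _ i (DirectSum.of (𝓕.EndComp P) i a i) = DirectSum.of _ i a
  rw [DirectSum.of_eq_same]

lemma gradedMul_homogeneous {i j l : ℤ} (h : i + j = l) (a : 𝓕.EndComp P i)
    (b : 𝓕.EndComp P j) :
    gradedMul (𝓕.twistedEndGrading P k) h (𝓕.homogeneous k i a) (𝓕.homogeneous k j b) =
      𝓕.homogeneous k l (𝓕.twistedComp h a b) := by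
  subst h
  exact Subtype.ext (DirectSum.of_mul_of a b)

lemma twistedHom_act (N : C) {i j l : ℤ} (h : i + j = l) (f : (𝓕.functor i).obj P ⟶ N)
    (a : 𝓕.twistedEndGrading P k j) :
    ((𝓕.twistedHom P k).obj N).act h f a =
      𝓕.twistedComp h f ((a : 𝓕.TwistedEnd P) j) := rfl

lemma twistedHom_act_homogeneous (N : C) {i j l : ℤ} (h : i + j = l)
    (f : (𝓕.functor i).obj P ⟶ N) (b : 𝓕.EndComp P j) :
    ((𝓕.twistedHom P k).obj N).act h f (𝓕.homogeneous k j b) = 𝓕.twistedComp h f b := by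
  rw [twistedHom_act]
  exact congrArg _ (DirectSum.of_eq_same _ _)

/-- The value of `φ : M ⟶ ⨁ hom(F_j P, N)` at an element of degree `j`, as a morphism in `C`. -/
def homApp {M : GrMod (𝓕.twistedEndGrading P k)} {N : C} (φ : M ⟶ (𝓕.twistedHom P k).obj N)
    {j : ℤ} : M.comp j →ₗ[k] ((𝓕.functor j).obj P ⟶ N) :=
  φ.app j

lemma homApp_act {M : GrMod (𝓕.twistedEndGrading P k)} {N : C}
    (φ : M ⟶ (𝓕.twistedHom P k).obj N) {i j l : ℤ} (h : i + j = l) (m : M.comp i)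
    (b : 𝓕.EndComp P j) :
    𝓕.homApp φ (M.act h m (𝓕.homogeneous k j b)) = 𝓕.twistedComp h (𝓕.homApp φ m) b :=
  (φ.app_act h m _).trans (𝓕.twistedHom_act_homogeneous N h _ b)

instance : (𝓕.twistedHom P k).Additive where
  map_add {_ _ f g} := by
    ext j m
    exact Preadditive.comp_add _ _ _ _ _ _

instance : (𝓕.twistedHom P k).Linear k where
  map_smul f c := by
    ext j m
    exact Linear.comp_smul _ _ _ _ _ _

section Untwist

variable [∀ n, (𝓕.functor n).IsEquivalence]

variable (k) in
/-- `hom(F_{i+j} P, F_i P) = hom(F_j P, P)`: every morphism on the left is the composite of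
`η^{ij}` and a unique `F_i b`. -/
noncomputable def untwist {i j l : ℤ} (h : i + j = l) :
    ((𝓕.functor l).obj P ⟶ (𝓕.functor i).obj P) ≃ₗ[k] 𝓕.EndComp P j :=
  LinearEquiv.symm <| LinearEquiv.ofBijective
    (𝓕.twistedCompLinear P k _ h (𝟙 _)) (by
      have e : ∀ b, 𝓕.twistedCompLinear P k _ h (𝟙 _) b =
          (𝓕.compat h).hom.app P ≫ (𝓕.functor i).map b := fun b =>
        congrArg _ (Category.comp_id _)
      refine ⟨fun b b' hb => ?_, fun f => ?_⟩
      · rw [e, e, cancel_epi] at hb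
        exact (𝓕.functor i).map_injective hb
      · refine ⟨(𝓕.functor i).preimage ((𝓕.compat h).inv.app P ≫ f), ?_⟩
        rw [e, Functor.map_preimage, Iso.hom_inv_id_app_assoc])

lemma id_twistedComp_untwist {i j l : ℤ} (h : i + j = l)
    (f : (𝓕.functor l).obj P ⟶ (𝓕.functor i).obj P) :
    𝓕.twistedComp h (𝟙 _) (𝓕.untwist k h f) = f :=
  (𝓕.untwist k h).symm_apply_apply f

lemma untwist_eq_iff {i j l : ℤ} (h : i + j = l)
    (f : (𝓕.functor l).obj P ⟶ (𝓕.functor i).obj P) (b : 𝓕.EndComp P j) :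
    𝓕.untwist k h f = b ↔ f = 𝓕.twistedComp h (𝟙 _) b :=
  ((𝓕.untwist k h).toEquiv.eq_symm_apply (x := b) (y := f)).symm

variable (k) in
/-- Every morphism `F_l P ⟶ F_i P` acts on `hom(F_i P, N)` as a homogeneous element of the twisted
endomorphism ring. -/
lemma twistedComp_untwist {i j l : ℤ} (h : i + j = l)
    (f : (𝓕.functor l).obj P ⟶ (𝓕.functor i).obj P) {N : C} (g : (𝓕.functor i).obj P ⟶ N) :
    𝓕.twistedComp h g (𝓕.untwist k h f) = f ≫ g := by
  rw [← id_twistedComp, id_twistedComp_untwist]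

lemma untwist_twistedComp {i j l p q : ℤ} (h : i + j = l) (hp : l + p = q) (hj : i + (j + p) = q)
    (f : (𝓕.functor l).obj P ⟶ (𝓕.functor i).obj P) (b : 𝓕.EndComp P p) :
    𝓕.untwist k hj (𝓕.twistedComp hp f b) = 𝓕.twistedComp rfl (𝓕.untwist k h f) b := by
  rw [untwist_eq_iff, ← 𝓕.twistedComp_assoc h hp rfl hj, id_twistedComp_untwist]

end Untwist

/-! ### The left adjoint of the twisted Hom functor -/

section Tensor

open Limits

variable [∀ n, (𝓕.functor n).IsEquivalence] [HasCoproducts.{u} C]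
  (M : GrMod (𝓕.twistedEndGrading P k))

/-- The coproduct of copies of the `F_j P`, one for each homogeneous element of degree `j`
of `M`. -/
noncomputable abbrev cover : C := ∐ fun x : Σ j, M.comp j => (𝓕.functor x.1).obj P

/-- The inclusion of the copy of `F_j P` that belongs to `m`. -/
noncomputable def coverι {j : ℤ} (m : M.comp j) : (𝓕.functor j).obj P ⟶ 𝓕.cover M :=
  Sigma.ι (fun x : Σ j, M.comp j => (𝓕.functor x.1).obj P) ⟨j, m⟩

open Classical in
/-- The projection of the coproduct to the copy of `F_j P` of index `x`. -/
noncomputable def coverπ (x : Σ j, M.comp j) : 𝓕.cover M ⟶ (𝓕.functor x.1).obj P :=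
  Sigma.π (fun x : Σ j, M.comp j => (𝓕.functor x.1).obj P) x

/-- The contribution of the summand of index `x` to the value of `coverEval` at `h`. -/
noncomputable def coverTerm (l : ℤ) (x : Σ j, M.comp j) :
    ((𝓕.functor l).obj P ⟶ 𝓕.cover M) →ₗ[k] M.comp l :=
  (M.act (add_sub_cancel x.1 l) x.2) ∘ₗ 𝓕.homogeneous k _ ∘ₗ
    (𝓕.untwist k (add_sub_cancel x.1 l)).toLinearMap ∘ₗ
      Linear.rightComp k _ (𝓕.coverπ M x)

lemma coverTerm_apply {l : ℤ} (x : Σ j, M.comp j) {b : ℤ} (hb : x.1 + b = l)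
    (h : (𝓕.functor l).obj P ⟶ 𝓕.cover M) :
    𝓕.coverTerm M l x h = M.act hb x.2 (𝓕.homogeneous k b
      (𝓕.untwist k hb (h ≫ 𝓕.coverπ M x))) := by
  obtain rfl : b = l - x.1 := by omega
  rfl

/-- Each contribution is linear over the twisted endomorphism ring. -/
lemma coverTerm_twistedComp {l p q : ℤ} (hp : l + p = q) (x : Σ j, M.comp j)
    (h : (𝓕.functor l).obj P ⟶ 𝓕.cover M) (b : 𝓕.EndComp P p) :
    𝓕.coverTerm M q x (𝓕.twistedComp hp h b) =
      M.act hp (𝓕.coverTerm M l x h) (𝓕.homogeneous k p b) := by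
  rw [𝓕.coverTerm_apply M x (show x.1 + (l - x.1 + p) = q by omega),
    𝓕.coverTerm_apply M x (add_sub_cancel x.1 l), 𝓕.twistedComp_postcomp,
    𝓕.untwist_twistedComp (add_sub_cancel x.1 l), M.act_act (add_sub_cancel x.1 l) hp rfl
      (show x.1 + (l - x.1 + p) = q by omega), gradedMul_homogeneous]

open Classical in
lemma coverTerm_coverι_self {j : ℤ} (m : M.comp j) :
    𝓕.coverTerm M j ⟨j, m⟩ (𝓕.coverι M m) = m := by
  rw [𝓕.coverTerm_apply M _ (add_zero j), coverι, coverπ, Sigma.ι_π_eq_id]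
  have : 𝓕.untwist k (add_zero j) (𝟙 ((𝓕.functor j).obj P)) = 𝓕.zero.hom.app P := by
    rw [untwist_eq_iff, 𝓕.twistedComp_zero]
  rw [this]
  exact M.act_one m

open Classical in
lemma coverTerm_coverι_of_ne {j : ℤ} (m : M.comp j) {x : Σ j, M.comp j} (hx : ⟨j, m⟩ ≠ x) :
    𝓕.coverTerm M j x (𝓕.coverι M m) = 0 := by
  rw [𝓕.coverTerm_apply M _ (add_sub_cancel _ _), coverι, coverπ, Sigma.ι_π_of_ne _ hx,
    map_zero, map_zero, map_zero]

lemma comp_coverι_eq_twistedComp {j l : ℤ} (m : M.comp j)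
    (g : (𝓕.functor l).obj P ⟶ (𝓕.functor j).obj P) :
    g ≫ 𝓕.coverι M m = 𝓕.twistedComp (add_sub_cancel j l) (𝓕.coverι M m)
      (𝓕.untwist k (add_sub_cancel j l) g) :=
  (𝓕.twistedComp_untwist k _ g _).symm

lemma coverTerm_comp_coverι_of_ne {j l : ℤ} (m : M.comp j)
    (g : (𝓕.functor l).obj P ⟶ (𝓕.functor j).obj P) {x : Σ j, M.comp j} (hx : ⟨j, m⟩ ≠ x) :
    𝓕.coverTerm M l x (g ≫ 𝓕.coverι M m) = 0 := by
  rw [comp_coverι_eq_twistedComp, coverTerm_twistedComp, 𝓕.coverTerm_coverι_of_ne M m hx,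
    map_zero, LinearMap.zero_apply]


variable {M} in
/-- By compact projectivity every morphism `F_l P ⟶ N` is a finite sum of morphisms that factor
through one copy of some `F_j P` in the coproduct, as soon as the coproduct covers `N`. -/
lemma mem_closure_coverι (hP : ∀ n, IsCompactProjective.{u} ((𝓕.functor n).obj P)) {l : ℤ} {N : C}
    (q : 𝓕.cover M ⟶ N) [Epi q] (h : (𝓕.functor l).obj P ⟶ N) :
    h ∈ AddSubgroup.closure {f | ∃ x : Σ j, M.comp j,
      ∃ g : (𝓕.functor l).obj P ⟶ (𝓕.functor x.1).obj P, g ≫ 𝓕.coverι M x.2 ≫ q = f} := by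
  refine hP l (Σ j, M.comp j) (fun x => (𝓕.functor x.1).obj P) N
    (fun x => 𝓕.coverι M x.2 ≫ q) h fun L t ht => ?_
  have : q ≫ t = 0 := Sigma.hom_ext _ _ fun x => by
    rw [comp_zero, ← ht x, Category.assoc]
    rfl
  rw [(cancel_epi q).1 (this.trans comp_zero.symm), comp_zero]

variable {M} in
lemma cover_hom_induction (hP : ∀ n, IsCompactProjective.{u} ((𝓕.functor n).obj P)) {l : ℤ}
    {p : ((𝓕.functor l).obj P ⟶ 𝓕.cover M) → Prop} (h0 : p 0)
    (hadd : ∀ f g, p f → p g → p (f + g)) (hneg : ∀ f, p f → p (-f))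
    (hι : ∀ {j : ℤ} (m : M.comp j) (g : (𝓕.functor l).obj P ⟶ (𝓕.functor j).obj P),
      p (g ≫ 𝓕.coverι M m)) (h : (𝓕.functor l).obj P ⟶ 𝓕.cover M) : p h := by
  refine AddSubgroup.closure_induction ?_ h0 (fun f g _ _ => hadd f g) (fun f _ => hneg f)
    (𝓕.mem_closure_coverι hP (𝟙 _) h)
  rintro _ ⟨x, g, rfl⟩
  rw [Category.comp_id]
  exact hι x.2 g

variable {M} in
lemma finite_support_coverTerm (hP : ∀ n, IsCompactProjective.{u} ((𝓕.functor n).obj P)) {l : ℤ}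
    (h : (𝓕.functor l).obj P ⟶ 𝓕.cover M) :
    (Function.support fun x => 𝓕.coverTerm M l x h).Finite := by
  induction h using 𝓕.cover_hom_induction hP with
  | h0 => simp
  | hadd f g hf hg =>
    refine (hf.union hg).subset ?_
    simp only [map_add]
    exact Function.support_add _ _
  | hneg f hf => simpa [Function.support] using hf
  | hι m g =>
    refine (Set.finite_singleton ⟨_, m⟩).subset fun x hx => ?_
    by_contra hne
    exact hx (𝓕.coverTerm_comp_coverι_of_ne M m g fun h => hne h.symm)

/-- A morphism `F_l P ⟶ ∐ F_j P` is a finite combination `∑ ι_m b_m` of the inclusions, with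
coefficients in the twisted endomorphism ring; its value is `∑ m b_m`. -/
noncomputable def coverEval (hP : ∀ n, IsCompactProjective.{u} ((𝓕.functor n).obj P)) (l : ℤ) :
    ((𝓕.functor l).obj P ⟶ 𝓕.cover M) →ₗ[k] M.comp l where
  toFun h := ∑ᶠ x, 𝓕.coverTerm M l x h
  map_add' f g := by
    simp only [map_add]
    exact finsum_add_distrib (𝓕.finite_support_coverTerm hP f)
      (𝓕.finite_support_coverTerm hP g)
  map_smul' c f := by
    simp only [map_smul]
    exact (smul_finsum' c (𝓕.finite_support_coverTerm hP f)).symm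

variable (hP : ∀ n, IsCompactProjective.{u} ((𝓕.functor n).obj P))

lemma coverEval_coverι {j : ℤ} (m : M.comp j) :
    𝓕.coverEval M hP j (𝓕.coverι M m) = m :=
  (finsum_eq_single _ ⟨j, m⟩ fun _ hx => 𝓕.coverTerm_coverι_of_ne M m hx.symm).trans
    (𝓕.coverTerm_coverι_self M m)

lemma coverEval_twistedComp {l p q : ℤ} (hp : l + p = q)
    (h : (𝓕.functor l).obj P ⟶ 𝓕.cover M) (b : 𝓕.EndComp P p) :
    𝓕.coverEval M hP q (𝓕.twistedComp hp h b) =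
      M.act hp (𝓕.coverEval M hP l h) (𝓕.homogeneous k p b) := by
  refine Eq.trans ?_ ((((M.act hp).flip (𝓕.homogeneous k p b)).toAddMonoidHom.map_finsum
    (𝓕.finite_support_coverTerm hP h)).symm)
  exact finsum_congr fun x => 𝓕.coverTerm_twistedComp M hp x h b

lemma coverEval_comp_coverι {j l : ℤ} (m : M.comp j)
    (g : (𝓕.functor l).obj P ⟶ (𝓕.functor j).obj P) :
    𝓕.coverEval M hP l (g ≫ 𝓕.coverι M m) = M.act (add_sub_cancel j l) m
      (𝓕.homogeneous k _ (𝓕.untwist k (add_sub_cancel j l) g)) := by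
  rw [comp_coverι_eq_twistedComp, coverEval_twistedComp, coverEval_coverι]


/-- The morphism from the coproduct that sends the copy of `F_j P` belonging to `m` to `N`
by `φ m`. -/
noncomputable def coverDesc {N : C} (φ : M ⟶ (𝓕.twistedHom P k).obj N) : 𝓕.cover M ⟶ N :=
  Sigma.desc fun x => 𝓕.homApp φ x.2

lemma coverι_coverDesc {N : C} (φ : M ⟶ (𝓕.twistedHom P k).obj N) {j : ℤ} (m : M.comp j) :
    𝓕.coverι M m ≫ 𝓕.coverDesc M φ = 𝓕.homApp φ m :=
  Sigma.ι_desc _ _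

/-- A homomorphism `φ` carries `∑ m b_m` to `∑ φ(m) b_m`. -/
lemma comp_coverDesc {N : C} (φ : M ⟶ (𝓕.twistedHom P k).obj N) {l : ℤ}
    (h : (𝓕.functor l).obj P ⟶ 𝓕.cover M) :
    h ≫ 𝓕.coverDesc M φ = 𝓕.homApp φ (𝓕.coverEval M hP l h) := by
  induction h using 𝓕.cover_hom_induction hP with
  | h0 => rw [zero_comp, map_zero, map_zero]
  | hadd f g hf hg => rw [Preadditive.add_comp, hf, hg, map_add, map_add]
  | hneg f hf => rw [Preadditive.neg_comp, hf, map_neg, map_neg]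
  | hι m g =>
    rw [coverEval_comp_coverι, homApp_act, Category.assoc, coverι_coverDesc,
      twistedComp_untwist]

/-- All morphisms from some `F_l P` to the coproduct whose value in `M` is zero. -/
noncomputable def relations :
    (∐ fun y : Σ l, LinearMap.ker (𝓕.coverEval M hP l) => (𝓕.functor y.1).obj P) ⟶ 𝓕.cover M :=
  Sigma.desc fun y => y.2.1

variable [HasCokernels C]

/-- The tensor product `M ⊗ P` over the twisted endomorphism ring: the quotient of the coproduct
of the `F_j P` by all morphisms from some `F_l P` whose value in `M` is zero. -/
noncomputable def tensor : C :=
  cokernel (𝓕.relations M hP)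

/-- The projection from the coproduct to `M ⊗ P`. -/
noncomputable def tensorπ : 𝓕.cover M ⟶ 𝓕.tensor M hP := cokernel.π _

lemma relations_tensorπ : 𝓕.relations M hP ≫ 𝓕.tensorπ M hP = 0 := cokernel.condition _

instance : Epi (𝓕.tensorπ M hP) := inferInstanceAs (Epi (cokernel.π _))

/-- Killing the morphisms of value zero kills no others: by compact projectivity a morphism that
dies is a finite combination of those killed, and the value is linear. -/
lemma comp_tensorπ_eq_zero_iff {l : ℤ} (h : (𝓕.functor l).obj P ⟶ 𝓕.cover M) :
    h ≫ 𝓕.tensorπ M hP = 0 ↔ 𝓕.coverEval M hP l h = 0 := by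
  constructor
  · intro h0
    have key := hP l (Σ l, LinearMap.ker (𝓕.coverEval M hP l)) (fun y => (𝓕.functor y.1).obj P)
      (𝓕.cover M) (fun y => y.2) h (fun L t ht => by
        have ht' : 𝓕.relations M hP ≫ t = 0 :=
          Sigma.hom_ext _ _ fun y => by rw [relations, Sigma.ι_desc_assoc, ht y, comp_zero]
        rw [← cokernel.π_desc _ t ht']
        exact (Category.assoc _ _ _).symm.trans ((congrArg (· ≫ _) h0).trans zero_comp))
    have hle : AddSubgroup.closure {f | ∃ y : Σ l, LinearMap.ker (𝓕.coverEval M hP l),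
        ∃ g : (𝓕.functor l).obj P ⟶ (𝓕.functor y.1).obj P, g ≫ y.2.1 = f} ≤
        (𝓕.coverEval M hP l).toAddMonoidHom.ker := by
      rw [AddSubgroup.closure_le]
      rintro _ ⟨⟨j, f, hf⟩, g, rfl⟩
      change 𝓕.coverEval M hP l (g ≫ f) = 0
      rw [← 𝓕.twistedComp_untwist k (add_sub_cancel j l) g, coverEval_twistedComp,
        LinearMap.mem_ker.1 hf, map_zero, LinearMap.zero_apply]
    exact hle key
  · intro h0
    have : h = Sigma.ι (fun y : Σ l, LinearMap.ker (𝓕.coverEval M hP l) =>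
        (𝓕.functor y.1).obj P) ⟨l, h, LinearMap.mem_ker.2 h0⟩ ≫ 𝓕.relations M hP :=
      (Sigma.ι_desc (f := fun y : Σ l, LinearMap.ker (𝓕.coverEval M hP l) =>
        (𝓕.functor y.1).obj P) (fun y => y.2.1) ⟨l, h, LinearMap.mem_ker.2 h0⟩).symm
    rw [this, Category.assoc, relations_tensorπ, comp_zero]

lemma comp_tensorπ_eq_iff {l : ℤ} (h h' : (𝓕.functor l).obj P ⟶ 𝓕.cover M) :
    h ≫ 𝓕.tensorπ M hP = h' ≫ 𝓕.tensorπ M hP ↔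
      𝓕.coverEval M hP l h = 𝓕.coverEval M hP l h' := by
  rw [← sub_eq_zero, ← Preadditive.sub_comp, comp_tensorπ_eq_zero_iff, map_sub, sub_eq_zero]

/-- The element `m ⊗ 1`, as a morphism `F_j P ⟶ M ⊗ P`. -/
noncomputable def tensorι (j : ℤ) : M.comp j →ₗ[k] ((𝓕.functor j).obj P ⟶ 𝓕.tensor M hP) where
  toFun m := 𝓕.coverι M m ≫ 𝓕.tensorπ M hP
  map_add' m m' := by
    rw [← Preadditive.add_comp, comp_tensorπ_eq_iff, map_add]
    simp only [coverEval_coverι]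
  map_smul' c m := by
    rw [← Linear.smul_comp, comp_tensorπ_eq_iff, map_smul]
    simp only [coverEval_coverι, RingHom.id_apply]

/-- The unit `M ⟶ ⨁ hom(F_j P, M ⊗ P)` of the adjunction. -/
noncomputable def tensorUnit : M ⟶ (𝓕.twistedHom P k).obj (𝓕.tensor M hP) where
  app j := 𝓕.tensorι M hP j
  app_act {i j l} h m a := by
    refine Eq.trans ?_ (𝓕.twistedComp_postcomp h (𝓕.coverι M m) _ (𝓕.tensorπ M hP))
    refine (𝓕.comp_tensorπ_eq_iff M hP _ _).2 ?_
    rw [coverEval_coverι, coverEval_twistedComp, coverEval_coverι]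
    exact congrArg _ (𝓕.homogeneous_apply j a).symm

lemma homApp_tensorUnit {j : ℤ} (m : M.comp j) :
    𝓕.homApp (𝓕.tensorUnit M hP) m = 𝓕.coverι M m ≫ 𝓕.tensorπ M hP := rfl

lemma bijective_tensorUnit (j : ℤ) : Function.Bijective ((𝓕.tensorUnit M hP).app j) := by
  refine ⟨fun m m' h => ?_, fun f => ?_⟩
  · have := (𝓕.comp_tensorπ_eq_iff M hP _ _).1 h
    rwa [coverEval_coverι, coverEval_coverι] at this
  · have hle : AddSubgroup.closure {f : (𝓕.functor j).obj P ⟶ 𝓕.tensor M hP |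
        ∃ x : Σ j, M.comp j,
        ∃ g : (𝓕.functor j).obj P ⟶ (𝓕.functor x.1).obj P,
          g ≫ 𝓕.coverι M x.2 ≫ 𝓕.tensorπ M hP = f} ≤
        (𝓕.homApp (𝓕.tensorUnit M hP)).toAddMonoidHom.range := by
      rw [AddSubgroup.closure_le]
      rintro _ ⟨x, g, rfl⟩
      refine ⟨M.act (add_sub_cancel x.1 j) x.2
        (𝓕.homogeneous k _ (𝓕.untwist k (add_sub_cancel x.1 j) g)), ?_⟩
      refine (𝓕.homApp_act (𝓕.tensorUnit M hP) _ _ _).trans ?_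
      rw [homApp_tensorUnit, 𝓕.twistedComp_untwist k]
    exact hle (𝓕.mem_closure_coverι hP (𝓕.tensorπ M hP) f)

/-- The morphism `M ⊗ P ⟶ N` adjoint to `φ`. -/
noncomputable def tensorDesc {N : C} (φ : M ⟶ (𝓕.twistedHom P k).obj N) :
    𝓕.tensor M hP ⟶ N :=
  cokernel.desc _ (𝓕.coverDesc M φ) (Sigma.hom_ext _ _ fun y => by
    rw [relations, Sigma.ι_desc_assoc, 𝓕.comp_coverDesc M hP, LinearMap.mem_ker.1 y.2.2,
      map_zero, comp_zero])

lemma tensorUnit_tensorDesc {N : C} (φ : M ⟶ (𝓕.twistedHom P k).obj N) :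
    𝓕.tensorUnit M hP ≫ (𝓕.twistedHom P k).map (𝓕.tensorDesc M hP φ) = φ := by
  ext j m
  have h : 𝓕.tensorπ M hP ≫ 𝓕.tensorDesc M hP φ = 𝓕.coverDesc M φ := cokernel.π_desc _ _ _
  change (𝓕.coverι M m ≫ 𝓕.tensorπ M hP) ≫ 𝓕.tensorDesc M hP φ = 𝓕.homApp φ m
  rw [Category.assoc, h, coverι_coverDesc]

end Tensor

/-! ### The twisted Hom functor as an equivalence -/

section Equivalence

open Limits

variable [∀ n, (𝓕.functor n).IsEquivalence]

lemma twistedHom_faithful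
    (hsep : (ObjectProperty.ofObj fun n : ℤ => (𝓕.functor n).obj P).IsSeparating) :
    (𝓕.twistedHom P k).Faithful where
  map_injective {X Y} f g hfg := hsep f g fun G hG h => by
    obtain ⟨n⟩ := hG
    exact congrArg (fun φ => GrMod.Hom.app φ n h) hfg

/-- If the `F_j P` are compact projective and generate `C`, then the twisted Hom functor is an
equivalence: its left adjoint `M ↦ M ⊗ P` has an invertible unit, and the counit becomes
invertible under the faithful twisted Hom functor, hence is a bimorphism. -/
theorem twistedHom_isEquivalence [HasCoproducts.{u} C] [HasCokernels C] [Balanced C]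
    (hP : ∀ n, IsCompactProjective.{u} ((𝓕.functor n).obj P))
    (hsep : (ObjectProperty.ofObj fun n : ℤ => (𝓕.functor n).obj P).IsSeparating) :
    (𝓕.twistedHom P k).IsEquivalence := by
  have hfaith := 𝓕.twistedHom_faithful (k := k) hsep
  have hunit : ∀ M, IsIso (𝓕.tensorUnit (k := k) M hP) := fun M =>
    GrMod.isIso_of_bijective _ (𝓕.bijective_tensorUnit M hP)
  have hcounit : ∀ N, IsIso (𝓕.tensorDesc _ hP (𝟙 ((𝓕.twistedHom P k).obj N))) := fun N => by
    have h1 := 𝓕.tensorUnit_tensorDesc _ hP (𝟙 ((𝓕.twistedHom P k).obj N))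
    have h2 : IsIso ((𝓕.twistedHom P k).map
        (𝓕.tensorDesc _ hP (𝟙 ((𝓕.twistedHom P k).obj N)))) := by
      rw [← IsIso.eq_inv_comp, Category.comp_id] at h1
      rw [h1]
      infer_instance
    have := (𝓕.twistedHom P k).mono_of_mono_map (inferInstance : Mono ((𝓕.twistedHom P k).map
      (𝓕.tensorDesc _ hP (𝟙 ((𝓕.twistedHom P k).obj N)))))
    have := (𝓕.twistedHom P k).epi_of_epi_map (inferInstance : Epi ((𝓕.twistedHom P k).map
      (𝓕.tensorDesc _ hP (𝟙 ((𝓕.twistedHom P k).obj N)))))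
    exact isIso_of_mono_of_epi _
  exact
    { faithful := hfaith
      full := ⟨fun {N N'} φ => by
        have := hcounit N
        have := hunit ((𝓕.twistedHom P k).obj N)
        refine ⟨inv (𝓕.tensorDesc _ hP (𝟙 _)) ≫ 𝓕.tensorDesc _ hP φ, ?_⟩
        have h1 := 𝓕.tensorUnit_tensorDesc _ hP (𝟙 ((𝓕.twistedHom P k).obj N))
        have h2 := 𝓕.tensorUnit_tensorDesc _ hP φ
        rw [Functor.map_comp, Functor.map_inv, IsIso.inv_comp_eq,
          ← cancel_epi (𝓕.tensorUnit ((𝓕.twistedHom P k).obj N) hP), h2, reassoc_of% h1]⟩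
      essSurj := ⟨fun M => by
        have := hunit M
        exact ⟨𝓕.tensor M hP, ⟨(asIso (𝓕.tensorUnit M hP)).symm⟩⟩⟩ }

end Equivalence

end ZSequence

/-! ### Restriction along an isomorphism of graded algebras -/

namespace GradedAlgIso

variable {k : Type v} [CommRing k] {S T : Type u} [Ring S] [Algebra k S] [Ring T]
  [Algebra k T] {𝒮 : ℤ → Submodule k S} {𝒯 : ℤ → Submodule k T} [GradedAlgebra 𝒮]
  [GradedAlgebra 𝒯] (σ : GradedAlgIso 𝒮 𝒯)

lemma symm_mem (n : ℤ) (t : T) (ht : t ∈ 𝒯 n) : σ.toAlgEquiv.symm t ∈ 𝒮 n := by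
  obtain ⟨s, rfl⟩ := σ.toAlgEquiv.surjective t
  rw [AlgEquiv.symm_apply_apply]
  -- `σ` maps the part of `s` of degree `n` to the part of `σ s` of degree `n`
  have key : ∀ s : S, σ.toAlgEquiv (DirectSum.decompose 𝒮 s n) =
      DirectSum.decompose 𝒯 (σ.toAlgEquiv s) n := by
    intro s
    induction s using DirectSum.Decomposition.inductionOn 𝒮 with
    | zero => simp
    | @homogeneous i m =>
      have hm : σ.toAlgEquiv m ∈ 𝒯 i := σ.map_mem i m m.2
      by_cases h : i = n
      · subst h
        rw [DirectSum.decompose_of_mem_same 𝒮 m.2, DirectSum.decompose_of_mem_same 𝒯 hm]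
      · rw [DirectSum.decompose_of_mem_ne 𝒮 m.2 h, DirectSum.decompose_of_mem_ne 𝒯 hm h, map_zero]
    | add x y hx hy => simp [hx, hy]
  have h := key s
  rw [DirectSum.decompose_of_mem_same 𝒯 ht] at h
  rw [← σ.toAlgEquiv.injective h]
  exact (DirectSum.decompose 𝒮 s n).2

/-- The inverse isomorphism. -/
def symm : GradedAlgIso 𝒯 𝒮 where
  toAlgEquiv := σ.toAlgEquiv.symm
  map_mem := σ.symm_mem

instance : σ.restrict.Additive where
  map_add := rfl

instance : σ.restrict.Linear k where
  map_smul _ _ := rfl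

instance : σ.restrict.IsEquivalence where
  faithful := ⟨fun {M N f g} h => by
    ext i m
    exact congrArg (fun φ : σ.restrict.obj M ⟶ σ.restrict.obj N => φ.app i m) h⟩
  full := ⟨fun {M N} f => by
    refine ⟨⟨f.app, fun {i j l} h m a => ?_⟩, rfl⟩
    have := f.app_act h m ⟨σ.toAlgEquiv.symm a, σ.symm_mem j a a.2⟩
    have e : σ.toAlgEquiv.toLinearMap.restrict (σ.map_mem j)
        ⟨σ.toAlgEquiv.symm a, σ.symm_mem j a a.2⟩ = a :=
      Subtype.ext (σ.toAlgEquiv.apply_symm_apply a)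
    change f.app l (M.act h m (σ.toAlgEquiv.toLinearMap.restrict (σ.map_mem j) _)) =
      N.act h (f.app i m) (σ.toAlgEquiv.toLinearMap.restrict (σ.map_mem j) _) at this
    rwa [e] at this⟩
  essSurj := ⟨fun M => by
    have e : ∀ (j : ℤ) (a : 𝒮 j), σ.symm.toAlgEquiv.toLinearMap.restrict (σ.symm.map_mem j)
        (σ.toAlgEquiv.toLinearMap.restrict (σ.map_mem j) a) = a := fun j a =>
      Subtype.ext (σ.toAlgEquiv.symm_apply_apply a)
    refine ⟨σ.symm.restrict.obj M, ⟨GrMod.isoOfBijective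
      ⟨fun i => LinearMap.id, fun {i j l} h m a => ?_⟩ fun i => Function.bijective_id⟩⟩
    exact congrArg (M.act h m) (e j a)⟩

end GradedAlgIso

/-! ### From a generating pair to an equivalence -/

section Backward

variable {k : Type v} [CommRing k] {R : Type u} [Ring R] [Algebra k R]
  {𝒜 : ℤ → Submodule k R} [GradedAlgebra 𝒜] {S : Type u} [Ring S] [Algebra k S]
  {𝒮 : ℤ → Submodule k S} [GradedAlgebra 𝒮]

instance (F : GrMod 𝒜 ≌ GrMod 𝒜) (n : ℤ) :
    ((ZSequence.ofEquivalence F).functor n).IsEquivalence :=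
  inferInstanceAs (F ^ n).functor.IsEquivalence

/-- A finitely generated projective `P` and a `P`-generative autoequivalence give an equivalence
with the graded modules over the twisted endomorphism ring. -/
theorem gradedEquivalent_of_gradedAlgIso (P : GrMod 𝒜) (F : GrMod 𝒜 ≌ GrMod 𝒜)
    [F.functor.Additive] [F.functor.Linear k] (hfg : P.FinitelyGenerated) (hP : Projective P)
    (hF : IsGenerative F P) (σ : GradedAlgIso 𝒮 (endGrading F P)) : GradedEquivalent 𝒜 𝒮 := by
  have hcp : ∀ n, IsCompactProjective.{u} (((ZSequence.ofEquivalence F).functor n).obj P) :=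
    fun n =>
      have : (F ^ n).functor.Additive := ofEquivalence_additive F n
      (GrMod.isCompactProjective_of_projective hfg).of_equivalence (F ^ n)
  have : (twistedHomFunctor F P).IsEquivalence :=
    (ZSequence.ofEquivalence F).twistedHom_isEquivalence hcp hF
  exact ⟨(twistedHomFunctor F P ⋙ σ.restrict).asEquivalence,
    inferInstanceAs (twistedHomFunctor F P ⋙ σ.restrict).Additive,
    inferInstanceAs ((twistedHomFunctor F P ⋙ σ.restrict).Linear k)⟩

end Backward

section Squares

variable {C : Type*} [Category* C]

lemma comp_comp_eq_of_squares {X₁ X₂ X₃ X₄ Y₂ Y₃ : C} {a : X₁ ⟶ X₂} {b : X₂ ⟶ X₃} {c : X₃ ⟶ X₄}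
    {a' : X₁ ⟶ Y₂} {b' : Y₂ ⟶ X₃} {d : Y₂ ⟶ Y₃} {e : Y₃ ⟶ X₄} (h : a ≫ b = a' ≫ b')
    (h' : d ≫ e = b' ≫ c) : a ≫ b ≫ c = (a' ≫ d) ≫ e := by
  rw [reassoc_of% h, Category.assoc, h']

lemma comp_comp_comp_eq_of_squares {X₁ X₂ X₃ X₄ X₅ Y₂ Y₃ Y₄ : C} {a : X₁ ⟶ X₂} {b : X₂ ⟶ X₃}
    {c : X₃ ⟶ X₄} {d : X₄ ⟶ X₅} {p : X₂ ⟶ Y₃} {r : X₁ ⟶ Y₂} {s : Y₂ ⟶ Y₃} {q : Y₃ ⟶ Y₄}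
    {w : X₃ ⟶ Y₄} {z : Y₄ ⟶ X₅} (h : a ≫ p = r ≫ s) (h' : p ≫ q = b ≫ w) (h'' : c ≫ d = w ≫ z) :
    (a ≫ b ≫ c) ≫ d = r ≫ s ≫ q ≫ z := by
  rw [← reassoc_of% h, reassoc_of% h', ← h'']
  simp only [Category.assoc]

end Squares

/-! ### Families of isomorphisms indexed by the integers -/

namespace ZSequence

section Families

variable {C : Type w} [Category.{w'} C] {D : Type*} [Category* D] (F : C ≌ C)
  {A B : ℤ → C ⥤ D}
  (a : ∀ n, A (n + 1) ≅ F.functor ⋙ A n) (b : ∀ n, B (n + 1) ≅ F.functor ⋙ B n)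

/-- `family` for functors to a category that embeds in `C`. -/
lemma exists_family (G : D ⥤ C) [G.Full] [G.Faithful] (s : A 0 ≅ B 0) :
    ∃ θ : ∀ n, A n ≅ B n, θ 0 = s ∧ ∀ n X, (θ (n + 1)).hom.app X ≫ (b n).hom.app X =
      (a n).hom.app X ≫ (θ n).hom.app (F.functor.obj X) := by
  let a' : ∀ n, A (n + 1) ⋙ G ≅ F.functor ⋙ A n ⋙ G := fun n => Functor.isoWhiskerRight (a n) G
  let b' : ∀ n, B (n + 1) ⋙ G ≅ F.functor ⋙ B n ⋙ G := fun n => Functor.isoWhiskerRight (b n) G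
  let θ := family F (A := fun n => A n ⋙ G) (B := fun n => B n ⋙ G) a' b'
    (Functor.isoWhiskerRight s G)
  let W := (Functor.FullyFaithful.ofFullyFaithful G).whiskeringRight C
  refine ⟨fun n => W.preimageIso (θ n), ?_, fun n X => ?_⟩
  · ext X
    apply G.map_injective
    exact NatTrans.congr_app (W.map_preimage (θ 0).hom) X
  · apply G.map_injective
    have h : ∀ n X, G.map ((W.preimageIso (θ n)).hom.app X) = (θ n).hom.app X := fun n X =>
      NatTrans.congr_app (W.map_preimage (θ n).hom) X
    rw [Functor.map_comp, Functor.map_comp, h, h]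
    exact family_spec F (A := fun n => A n ⋙ G) (B := fun n => B n ⋙ G) a' b' _ n X

lemma family_ext_of_faithful (G : D ⥤ C) [G.Faithful] (s t : ∀ n, A n ⟶ B n)
    (hs : ∀ n X, (s (n + 1)).app X ≫ (b n).hom.app X =
      (a n).hom.app X ≫ (s n).app (F.functor.obj X))
    (ht : ∀ n X, (t (n + 1)).app X ≫ (b n).hom.app X =
      (a n).hom.app X ≫ (t n).app (F.functor.obj X))
    (h0 : s 0 = t 0) (n : ℤ) : s n = t n := by
  have := family_ext F (A := fun n => A n ⋙ G) (B := fun n => B n ⋙ G)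
    (fun n => Functor.isoWhiskerRight (a n) G) (fun n => Functor.isoWhiskerRight (b n) G)
    (fun n => Functor.whiskerRight (s n) G) (fun n => Functor.whiskerRight (t n) G)
    (fun n X => by
      simp only [Functor.whiskerRight_app, Functor.isoWhiskerRight_hom]
      exact (G.map_comp _ _).symm.trans ((congrArg G.map (hs n X)).trans (G.map_comp _ _)))
    (fun n X => by
      simp only [Functor.whiskerRight_app, Functor.isoWhiskerRight_hom]
      exact (G.map_comp _ _).symm.trans ((congrArg G.map (ht n X)).trans (G.map_comp _ _)))
    (by rw [h0]) n
  ext X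
  exact G.map_injective (NatTrans.congr_app this X)

end Families

end ZSequence

/-! ### Composition of shifts -/

namespace GrMod

variable {k : Type v} [CommRing k] {S : Type u} [Ring S] [Algebra k S]
  {𝒮 : ℤ → Submodule k S} [GradedAlgebra 𝒮]

lemma compEquiv_rfl (M : GrMod 𝒮) {i : ℤ} (m : M.comp i) : M.compEquiv rfl m = m :=
  M.act_one m

lemma compEquiv_compEquiv (M : GrMod 𝒮) {i j l : ℤ} (h : i = j) (h' : j = l) (m : M.comp i) :
    M.compEquiv h' (M.compEquiv h m) = M.compEquiv (h.trans h') m := by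
  subst h h'
  rw [compEquiv_rfl, compEquiv_rfl]

lemma shiftObj_compEquiv (M : GrMod 𝒮) {n i j : ℤ} (h : i = j) (m : M.comp (i - n)) :
    (shiftObj n M).compEquiv h m = M.compEquiv (congrArg (· - n) h) m := by
  subst h
  exact ((shiftObj n M).compEquiv_rfl m).trans (M.compEquiv_rfl m).symm

variable (𝒮) in
/-- `M⟨l⟩ ≅ M⟨j⟩⟨i⟩` for `i + j = l`. -/
def shiftAdd {i j l : ℤ} (h : i + j = l) :
    shiftFunctor 𝒮 l ≅ shiftFunctor 𝒮 j ⋙ shiftFunctor 𝒮 i :=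
  NatIso.ofComponents
    (fun M =>
      { hom := ⟨fun x => (M.compEquiv (show x - l = x - i - j by omega)).toLinearMap,
          fun _ m a => M.compEquiv_act _ _ _ _ m a⟩
        inv := ⟨fun x => (M.compEquiv (show x - l = x - i - j by omega)).symm.toLinearMap,
          fun _ m a => M.compEquiv_act (by omega) (by omega) _ _ m a⟩
        hom_inv_id := by
          ext x m
          exact (M.compEquiv (show x - l = x - i - j by omega)).symm_apply_apply m
        inv_hom_id := by
          ext x m
          exact (M.compEquiv (show x - l = x - i - j by omega)).apply_symm_apply m })
    (fun f => by
      ext x m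
      exact (app_compEquiv f (show x - l = x - i - j by omega) m).symm)

lemma shiftAdd_hom_app {i j l : ℤ} (h : i + j = l) (M : GrMod 𝒮) (x : ℤ)
    (m : M.comp (x - l)) :
    ((shiftAdd 𝒮 h).hom.app M).app x m = M.compEquiv (by omega) m := rfl

lemma shiftAdd_assoc {i j l p q r : ℤ} (hp : i + j = p) (hpl : p + l = r) (hq : j + l = q)
    (hiq : i + q = r) (M : GrMod 𝒮) :
    (shiftAdd 𝒮 hiq).hom.app M ≫ (shiftFunctor 𝒮 i).map ((shiftAdd 𝒮 hq).hom.app M) =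
      (shiftAdd 𝒮 hpl).hom.app M ≫ (shiftAdd 𝒮 hp).hom.app ((shiftFunctor 𝒮 l).obj M) := by
  ext x m
  refine (M.compEquiv_compEquiv (show x - r = x - i - q by omega)
    (show x - i - q = x - i - j - l by omega) m).trans ?_
  refine (M.compEquiv_compEquiv (show x - r = x - p - l by omega)
    (show x - p - l = x - i - j - l by omega) m).symm.trans ?_
  exact (M.shiftObj_compEquiv (show x - p = x - i - j by omega) _).symm

variable (𝒮) in
/-- `M ≅ M⟨0⟩`. -/
def shiftZero : 𝟭 (GrMod 𝒮) ≅ shiftFunctor 𝒮 0 :=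
  NatIso.ofComponents
    (fun M =>
      { hom := ⟨fun x => (M.compEquiv (show x = x - 0 by omega)).toLinearMap,
          fun _ m a => M.compEquiv_act _ _ _ _ m a⟩
        inv := ⟨fun x => (M.compEquiv (show x = x - 0 by omega)).symm.toLinearMap,
          fun _ m a => M.compEquiv_act (by omega) (by omega) _ _ m a⟩
        hom_inv_id := by
          ext x m
          exact (M.compEquiv (show x = x - 0 by omega)).symm_apply_apply m
        inv_hom_id := by
          ext x m
          exact (M.compEquiv (show x = x - 0 by omega)).apply_symm_apply m })
    (fun f => by
      ext x m
      exact (app_compEquiv f (show x = x - 0 by omega) m).symm)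

lemma shiftZero_hom_app (M : GrMod 𝒮) (x : ℤ) (m : M.comp x) :
    ((shiftZero 𝒮).hom.app M).app x m = M.compEquiv (by omega) m := rfl

end GrMod

/-! ### Powers of the pulled back shift -/

section Pullback

variable {k : Type v} [CommRing k] {R : Type u} [Ring R] [Algebra k R]
  {𝒜 : ℤ → Submodule k R} [GradedAlgebra 𝒜] {S : Type u} [Ring S] [Algebra k S]
  {𝒮 : ℤ → Submodule k S} [GradedAlgebra 𝒮] (Φ : GrMod 𝒜 ≌ GrMod 𝒮)

/-- `(Φ X)⟨n + 1⟩ ≅ (Φ (F X))⟨n⟩` for the pulled back shift `F`. -/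
def shiftSuccPullback (n : ℤ) : Φ.functor ⋙ GrMod.shiftFunctor 𝒮 (n + 1) ≅
    (pullback Φ (GrMod.shift 𝒮)).functor ⋙ Φ.functor ⋙ GrMod.shiftFunctor 𝒮 n :=
  NatIso.ofComponents
    (fun X => (GrMod.shiftAdd 𝒮 (i := n) (j := 1) rfl).app (Φ.functor.obj X) ≪≫
      (GrMod.shiftFunctor 𝒮 n).mapIso
        (Φ.counitIso.symm.app ((GrMod.shiftFunctor 𝒮 1).obj (Φ.functor.obj X))))
    (fun {X Y} f => by
      have n1 := (GrMod.shiftAdd 𝒮 (i := n) (j := 1) rfl).hom.naturality (Φ.functor.map f)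
      have n2 := congrArg (GrMod.shiftFunctor 𝒮 n).map
        (Φ.counitIso.inv.naturality ((GrMod.shiftFunctor 𝒮 1).map (Φ.functor.map f)))
      rw [Functor.map_comp, Functor.map_comp] at n2
      exact (Category.assoc _ _ _).symm.trans ((congrArg (· ≫ _) n1).trans
        ((Category.assoc _ _ _).trans ((congrArg (_ ≫ ·) n2).trans
          (Category.assoc _ _ _).symm))))

lemma exists_powPullback :
    ∃ θ : ∀ n : ℤ, ((pullback Φ (GrMod.shift 𝒮)) ^ n).functor ⋙ Φ.functor ≅
        Φ.functor ⋙ GrMod.shiftFunctor 𝒮 n,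
      (∀ X, (θ 0).hom.app X = (GrMod.shiftZero 𝒮).hom.app (Φ.functor.obj X)) ∧
      ∀ n X, (θ (n + 1)).hom.app X ≫ (shiftSuccPullback Φ n).hom.app X =
        Φ.functor.map ((ZSequence.powSucc (pullback Φ (GrMod.shift 𝒮)) n).hom.app X) ≫
          (θ n).hom.app ((pullback Φ (GrMod.shift 𝒮)).functor.obj X) := by
  obtain ⟨θ, h0, h⟩ := ZSequence.exists_family (pullback Φ (GrMod.shift 𝒮))
    (A := fun n => ((pullback Φ (GrMod.shift 𝒮)) ^ n).functor ⋙ Φ.functor)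
    (B := fun n => Φ.functor ⋙ GrMod.shiftFunctor 𝒮 n)
    (fun n => Functor.isoWhiskerRight
      (ZSequence.powSucc (pullback Φ (GrMod.shift 𝒮)) n) Φ.functor ≪≫
      Functor.associator _ _ _)
    (shiftSuccPullback Φ) Φ.inverse
    (Functor.isoWhiskerLeft Φ.functor (GrMod.shiftZero 𝒮))
  refine ⟨θ, fun X => by rw [h0]; rfl, fun n X => (h n X).trans ?_⟩
  exact congrArg (· ≫ (θ n).hom.app ((pullback Φ (GrMod.shift 𝒮)).functor.obj X))
    (Category.comp_id _)

/-- The powers of the pulled back shift are the pulled back powers of the shift: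
`Φ F^n ≅ 𝓢^n Φ`, where `𝓢^n` is written as `M ↦ M⟨n⟩`. -/
noncomputable def powPullback (n : ℤ) : ((pullback Φ (GrMod.shift 𝒮)) ^ n).functor ⋙ Φ.functor ≅
    Φ.functor ⋙ GrMod.shiftFunctor 𝒮 n :=
  (exists_powPullback Φ).choose n

lemma powPullback_zero (X : GrMod 𝒜) : (powPullback Φ 0).hom.app X =
    (GrMod.shiftZero 𝒮).hom.app (Φ.functor.obj X) :=
  (exists_powPullback Φ).choose_spec.1 X

lemma powPullback_succ (n : ℤ) (X : GrMod 𝒜) :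
    (powPullback Φ (n + 1)).hom.app X ≫ (shiftSuccPullback Φ n).hom.app X =
      Φ.functor.map ((ZSequence.powSucc (pullback Φ (GrMod.shift 𝒮)) n).hom.app X) ≫
        (powPullback Φ n).hom.app ((pullback Φ (GrMod.shift 𝒮)).functor.obj X) :=
  (exists_powPullback Φ).choose_spec.2 n X

lemma powPullback_succ_of {n m : ℤ} (h : n + 1 = m) (X : GrMod 𝒜) :
    (powPullback Φ m).hom.app X ≫ (GrMod.shiftAdd 𝒮 h).hom.app (Φ.functor.obj X) ≫
        (GrMod.shiftFunctor 𝒮 n).map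
          (Φ.counitIso.inv.app ((GrMod.shiftFunctor 𝒮 1).obj (Φ.functor.obj X))) =
      Φ.functor.map ((ZSequence.powSuccOf (pullback Φ (GrMod.shift 𝒮)) h).hom.app X) ≫
        (powPullback Φ n).hom.app ((pullback Φ (GrMod.shift 𝒮)).functor.obj X) := by
  subst h
  have e : (ZSequence.powSuccOf (pullback Φ (GrMod.shift 𝒮)) (n := n) rfl) =
      ZSequence.powSucc (pullback Φ (GrMod.shift 𝒮)) n := by simp [ZSequence.powSuccOf]
  rw [e]
  exact powPullback_succ Φ n X

/-- Under `Φ F^n ≅ 𝓢^n Φ` the compatibility isomorphisms `F^l ≅ F^i F^j` become the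
identifications `M⟨l⟩ ≅ M⟨j⟩⟨i⟩`. -/
lemma powPullback_add {i j l : ℤ} (h : i + j = l) (X : GrMod 𝒜) :
    (powPullback Φ l).hom.app X ≫ (GrMod.shiftAdd 𝒮 h).hom.app (Φ.functor.obj X) =
      Φ.functor.map ((ZSequence.powCompat (pullback Φ (GrMod.shift 𝒮)) h).hom.app X) ≫
        (powPullback Φ i).hom.app (((pullback Φ (GrMod.shift 𝒮)) ^ j).functor.obj X) ≫
          (GrMod.shiftFunctor 𝒮 i).map ((powPullback Φ j).hom.app X) := by
  subst h
  let F := pullback Φ (GrMod.shift 𝒮)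
  have := ZSequence.family_ext_of_faithful F
    (A := fun j => (F ^ (i + j)).functor ⋙ Φ.functor)
    (B := fun j => (Φ.functor ⋙ GrMod.shiftFunctor 𝒮 j) ⋙ GrMod.shiftFunctor 𝒮 i)
    (fun j => Functor.isoWhiskerRight (ZSequence.powSuccOf F (add_assoc i j 1)) Φ.functor)
    (fun j => Functor.isoWhiskerRight (shiftSuccPullback Φ j) (GrMod.shiftFunctor 𝒮 i)) Φ.inverse
    (fun j => (powPullback Φ (i + j)).hom ≫
      Functor.whiskerLeft Φ.functor (GrMod.shiftAdd 𝒮 (i := i) (j := j) rfl).hom)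
    (fun j => Functor.whiskerRight (ZSequence.powCompat F (i := i) (j := j) rfl).hom Φ.functor ≫
      Functor.whiskerLeft (F ^ j).functor (powPullback Φ i).hom ≫
        Functor.whiskerRight (powPullback Φ j).hom (GrMod.shiftFunctor 𝒮 i))
    (fun n X => by
      -- the recursion of `powPullback` at `i + n`
      have h1 := powPullback_succ_of Φ (add_assoc i n 1) X
      have h2 : (GrMod.shiftAdd 𝒮 (i := i) (j := n + 1) rfl).hom.app (Φ.functor.obj X) ≫
          (GrMod.shiftFunctor 𝒮 i).map ((shiftSuccPullback Φ n).hom.app X) =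
        ((GrMod.shiftAdd 𝒮 (add_assoc i n 1)).hom.app (Φ.functor.obj X) ≫
          (GrMod.shiftFunctor 𝒮 (i + n)).map
            (Φ.counitIso.inv.app ((GrMod.shiftFunctor 𝒮 1).obj (Φ.functor.obj X)))) ≫
          (GrMod.shiftAdd 𝒮 (i := i) (j := n) rfl).hom.app
            (Φ.functor.obj (F.functor.obj X)) := by
        have n1 := (GrMod.shiftAdd 𝒮 (i := i) (j := n) rfl).hom.naturality
          (Φ.counitIso.inv.app ((GrMod.shiftFunctor 𝒮 1).obj (Φ.functor.obj X)))
        have n2 := GrMod.shiftAdd_assoc (i := i) (j := n) (l := 1) rfl (add_assoc i n 1) rfl rfl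
          (Φ.functor.obj X)
        exact comp_comp_eq_of_squares n2 n1
      refine (Category.assoc _ _ _).trans ((congrArg (_ ≫ ·) h2).trans ?_)
      refine (Category.assoc _ _ _).symm.trans ((congrArg (· ≫ _) h1).trans ?_)
      exact Category.assoc _ _ _)
    (fun n X => by
      -- the recursions of `powPullback` at `n` and of `powCompat`, glued by naturality
      have h1 := congrArg (GrMod.shiftFunctor 𝒮 i).map (powPullback_succ Φ n X)
      rw [Functor.map_comp, Functor.map_comp] at h1
      have h2 := (powPullback Φ i).hom.naturality ((ZSequence.powSucc F n).hom.app X)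
      have h3 := congrArg Φ.functor.map (ZSequence.powCompat_succ F (i := i) (j := n) rfl rfl rfl
        (add_assoc i n 1) X)
      have e : (ZSequence.powSuccOf F (n := n) rfl) = ZSequence.powSucc F n := by
        simp [ZSequence.powSuccOf]
      rw [e, Functor.map_comp, Functor.map_comp] at h3
      exact comp_comp_comp_eq_of_squares h3 h2 h1)
    (by
      have key : ∀ (l : ℤ) (h : i + 0 = l) (X : GrMod 𝒜),
          (powPullback Φ l).hom.app X ≫ (GrMod.shiftAdd 𝒮 h).hom.app (Φ.functor.obj X) =
            Φ.functor.map ((ZSequence.powCompat F h).hom.app X) ≫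
              (powPullback Φ i).hom.app X ≫
                (GrMod.shiftFunctor 𝒮 i).map ((powPullback Φ 0).hom.app X) := by
        intro l h X
        obtain rfl : i = l := by omega
        rw [powPullback_zero]
        exact (Category.id_comp _).symm.trans (congrArg (· ≫ _)
          ((Φ.functor.map_id _).symm.trans
            (congrArg Φ.functor.map (ZSequence.powCompat_zero F h X).symm)))
      exact NatTrans.ext (funext (key (i + 0) rfl))) j
  exact NatTrans.congr_app this X

end Pullback

/-! ### Evaluation at the generators -/

section Evaluation

variable {k : Type v} [CommRing k] {R : Type u} [Ring R] [Algebra k R]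
  {𝒜 : ℤ → Submodule k R} [GradedAlgebra 𝒜] {S : Type u} [Ring S] [Algebra k S]
  {𝒮 : ℤ → Submodule k S} [GradedAlgebra 𝒮] (Φ : GrMod 𝒜 ≌ GrMod 𝒮)

lemma isCompactProjective_inverse_regular [Φ.functor.Additive] :
    IsCompactProjective.{u} (Φ.inverse.obj (GrMod.regular 𝒮)) :=
  have : Φ.symm.functor.Additive := inferInstanceAs Φ.inverse.Additive
  (GrMod.isFreeOn_regularOne.isCompactProjective).of_equivalence Φ.symm

/-- The element of `Φ (Ψ S) ≅ S` that corresponds to `1`. -/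
def pullbackOne : (Φ.functor.obj (Φ.inverse.obj (GrMod.regular 𝒮))).comp 0 :=
  (Φ.counitIso.inv.app (GrMod.regular 𝒮)).app 0 (GrMod.regularOne 𝒮)

lemma isFreeOn_pullbackOne : GrMod.IsFreeOn _ (pullbackOne Φ) :=
  GrMod.isFreeOn_regularOne.of_iso (Φ.counitIso.app (GrMod.regular 𝒮)).symm

/-- The generator of degree `n` of `Φ (F^n (Ψ S)) ≅ S⟨n⟩`, for the pulled back shift `F`. -/
noncomputable def pullbackGen (n : ℤ) :
    (Φ.functor.obj (((pullback Φ (GrMod.shift 𝒮)) ^ n).functor.obj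
      (Φ.inverse.obj (GrMod.regular 𝒮)))).comp n :=
  ((powPullback Φ n).inv.app (Φ.inverse.obj (GrMod.regular 𝒮))).app n
    (GrMod.compEquiv _ (show 0 = n - n by omega) (pullbackOne Φ))

lemma isFreeOn_pullbackGen (n : ℤ) : GrMod.IsFreeOn _ (pullbackGen Φ n) :=
  ((isFreeOn_pullbackOne Φ).shift n n (by omega)).of_iso
    ((powPullback Φ n).app (Φ.inverse.obj (GrMod.regular 𝒮))).symm

lemma powPullback_pullbackGen (n : ℤ) :
    ((powPullback Φ n).hom.app (Φ.inverse.obj (GrMod.regular 𝒮))).app n (pullbackGen Φ n) =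
      GrMod.compEquiv _ (show 0 = n - n by omega) (pullbackOne Φ) :=
  congrArg (fun f : Φ.functor ⋙ GrMod.shiftFunctor 𝒮 n ⟶ Φ.functor ⋙ GrMod.shiftFunctor 𝒮 n =>
    (f.app (Φ.inverse.obj (GrMod.regular 𝒮))).app n
      (GrMod.compEquiv _ (show 0 = n - n by omega) (pullbackOne Φ))) (powPullback Φ n).inv_hom_id

lemma pullbackGen_zero : pullbackGen Φ 0 = pullbackOne Φ := by
  apply (GrMod.bijective_of_iso ((powPullback Φ 0).app _) 0).1
  refine (powPullback_pullbackGen Φ 0).trans ?_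
  refine (GrMod.shiftZero_hom_app _ 0 _).symm.trans ?_
  exact congrArg (fun f => GrMod.Hom.app f 0 (pullbackOne Φ)) (powPullback_zero Φ _).symm

/-- The image of the generator of `F^{i+j} P` in `(F^i (F^j P))` is the shifted generator
of `F^j P`. -/
lemma powPullback_powCompat_pullbackGen {i j l : ℤ} (h : i + j = l) :
    ((powPullback Φ i).hom.app (((pullback Φ (GrMod.shift 𝒮)) ^ j).functor.obj
      (Φ.inverse.obj (GrMod.regular 𝒮)))).app l
      ((Φ.functor.map ((ZSequence.powCompat (pullback Φ (GrMod.shift 𝒮)) h).hom.app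
        (Φ.inverse.obj (GrMod.regular 𝒮)))).app l (pullbackGen Φ l)) =
      GrMod.compEquiv _ (show j = l - i by omega) (pullbackGen Φ j) := by
  apply (GrMod.bijective_of_iso ((powPullback Φ j).app
    (Φ.inverse.obj (GrMod.regular 𝒮))) (l - i)).1
  have h1 := congrArg (fun f => GrMod.Hom.app f l (pullbackGen Φ l))
    (powPullback_add Φ h (Φ.inverse.obj (GrMod.regular 𝒮)))
  refine h1.symm.trans ?_
  refine (GrMod.shiftAdd_hom_app h _ l _).trans ?_
  refine Eq.trans ?_ (GrMod.app_compEquiv ((powPullback Φ j).hom.app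
    (Φ.inverse.obj (GrMod.regular 𝒮))) (show j = l - i by omega) (pullbackGen Φ j)).symm
  rw [powPullback_pullbackGen]
  erw [powPullback_pullbackGen]
  refine (GrMod.compEquiv_compEquiv _ _ _ _).trans ?_
  exact ((GrMod.shiftObj_compEquiv _ _ _).trans (GrMod.compEquiv_compEquiv _ _ _ _)).symm

variable [Φ.functor.Additive] [Φ.functor.Linear k]

/-- `hom(F^n (Ψ S), N) = hom(S⟨n⟩, Φ N) = (Φ N)_n`, by evaluation at the generator. -/
noncomputable def pullbackEval (N : GrMod 𝒜) (n : ℤ) :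
    (((pullback Φ (GrMod.shift 𝒮)) ^ n).functor.obj (Φ.inverse.obj (GrMod.regular 𝒮)) ⟶ N) ≃ₗ[k]
      (Φ.functor.obj N).comp n :=
  LinearEquiv.ofBijective
    { toFun := fun f => (Φ.functor.map f).app n (pullbackGen Φ n)
      map_add' := fun f g => by rw [Functor.map_add]; rfl
      map_smul' := fun c f => by rw [Functor.map_smul]; rfl }
    (((isFreeOn_pullbackGen Φ n).bijective_eval _).comp
      ⟨Φ.functor.map_injective, Φ.functor.map_surjective⟩)

lemma pullbackEval_apply {N : GrMod 𝒜} {n : ℤ}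
    (f : ((pullback Φ (GrMod.shift 𝒮)) ^ n).functor.obj
      (Φ.inverse.obj (GrMod.regular 𝒮)) ⟶ N) :
    pullbackEval Φ N n f = (Φ.functor.map f).app n (pullbackGen Φ n) := rfl

lemma pullbackEval_comp {N N' : GrMod 𝒜} {n : ℤ}
    (f : ((pullback Φ (GrMod.shift 𝒮)) ^ n).functor.obj
      (Φ.inverse.obj (GrMod.regular 𝒮)) ⟶ N) (g : N ⟶ N') :
    pullbackEval Φ N' n (f ≫ g) = (Φ.functor.map g).app n (pullbackEval Φ N n f) := by
  rw [pullbackEval_apply, Functor.map_comp]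
  rfl

lemma isGenerative_pullback : IsGenerative (pullback Φ (GrMod.shift 𝒮))
    (Φ.inverse.obj (GrMod.regular 𝒮)) := by
  intro X Y f g h
  apply Φ.functor.map_injective
  ext n m
  obtain ⟨t, rfl⟩ := (pullbackEval Φ X n).surjective m
  rw [← pullbackEval_comp, ← pullbackEval_comp, h _ (ObjectProperty.ofObj_apply _ n) t]

/-- Evaluation turns the twisted composition into the action of `S`. -/
lemma pullbackEval_twistedComp {N : GrMod 𝒜} {i j l : ℤ} (h : i + j = l)
    (f : ((pullback Φ (GrMod.shift 𝒮)) ^ i).functor.obj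
      (Φ.inverse.obj (GrMod.regular 𝒮)) ⟶ N)
    (b : ((pullback Φ (GrMod.shift 𝒮)) ^ j).functor.obj
      (Φ.inverse.obj (GrMod.regular 𝒮)) ⟶ Φ.inverse.obj (GrMod.regular 𝒮)) (s : 𝒮 j)
    (hb : pullbackEval Φ _ j b = GrMod.act _ (zero_add j) (pullbackOne Φ) s) :
    pullbackEval Φ N l
      ((ZSequence.ofEquivalence (pullback Φ (GrMod.shift 𝒮))).twistedComp h f b) =
      (Φ.functor.obj N).act h (pullbackEval Φ N i f) s := by
  let F := pullback Φ (GrMod.shift 𝒮)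
  let P := Φ.inverse.obj (GrMod.regular 𝒮)
  have key : (Φ.functor.map ((F ^ i).functor.map b)).app l
      ((Φ.functor.map ((ZSequence.powCompat F h).hom.app P)).app l (pullbackGen Φ l)) =
      (Φ.functor.obj ((F ^ i).functor.obj P)).act h (pullbackGen Φ i) s := by
    apply (GrMod.bijective_of_iso ((powPullback Φ i).app P) l).1
    have n := congrArg (fun f => GrMod.Hom.app f l
      ((Φ.functor.map ((ZSequence.powCompat F h).hom.app P)).app l (pullbackGen Φ l)))
      ((powPullback Φ i).hom.naturality b)
    refine n.trans ?_
    refine (congrArg (GrMod.Hom.app (Φ.functor.map b) (l - i))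
      (powPullback_powCompat_pullbackGen Φ h)).trans ?_
    refine (GrMod.app_compEquiv (Φ.functor.map b) (show j = l - i by omega)
      (pullbackGen Φ j)).trans ?_
    refine (congrArg _ hb).trans ?_
    refine (GrMod.compEquiv_act _ (show 0 = i - i by omega) (show j = l - i by omega) _
      (by omega) _ s).trans ?_
    refine Eq.trans ?_ (GrMod.Hom.app_act ((powPullback Φ i).hom.app P) h (pullbackGen Φ i) s).symm
    exact congrArg (fun x => GrMod.act _ _ x s) (powPullback_pullbackGen Φ i).symm
  have e : pullbackEval Φ N l ((ZSequence.ofEquivalence F).twistedComp h f b) =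
      (Φ.functor.map f).app l ((Φ.functor.map ((F ^ i).functor.map b)).app l
        ((Φ.functor.map ((ZSequence.powCompat F h).hom.app P)).app l (pullbackGen Φ l))) := by
    refine (congrArg (fun g => GrMod.Hom.app g l (pullbackGen Φ l))
      (Φ.functor.map_comp ((ZSequence.powCompat F h).hom.app P)
        ((F ^ i).functor.map b ≫ f))).trans ?_
    exact congrArg (fun g => GrMod.Hom.app g l _) (Φ.functor.map_comp ((F ^ i).functor.map b) f)
  exact e.trans ((congrArg _ key).trans ((Φ.functor.map f).app_act h _ s))

end Evaluation

/-! ### The isomorphism with the twisted endomorphism ring -/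

namespace ZSequence

variable {C : Type w} [Category.{u} C] (𝓕 : ZSequence C) {P : C} [Preadditive C]
  {k : Type v} [CommRing k] [Linear k C] {S : Type u} [Ring S] [Algebra k S] {𝒮 : ℤ → Submodule k S}
  [GradedAlgebra 𝒮] (τ : ∀ n, 𝒮 n ≃ₗ[k] 𝓕.EndComp P n)

/-- The linear isomorphism with the given homogeneous components. -/
noncomputable def twistedEndLinearEquiv : S ≃ₗ[k] 𝓕.TwistedEnd P :=
  (DirectSum.decomposeLinearEquiv 𝒮).trans (DFinsupp.mapRange.linearEquiv τ)

lemma twistedEndLinearEquiv_coe {n : ℤ} (s : 𝒮 n) :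
    𝓕.twistedEndLinearEquiv τ (s : S) = DirectSum.of (𝓕.EndComp P) n (τ n s) := by
  change DFinsupp.mapRange.linearEquiv τ (DirectSum.decompose 𝒮 (s : S)) = _
  rw [DirectSum.decompose_coe]
  exact DFinsupp.mapRange_single (hf := fun i => map_zero (τ i))

variable [∀ n, (𝓕.functor n).Additive] [∀ n, (𝓕.functor n).Linear k]
  (h1 : τ 0 ⟨1, SetLike.one_mem_graded 𝒮⟩ = 𝓕.zero.hom.app P)
  (hmul : ∀ ⦃i j l : ℤ⦄ (h : i + j = l) (s : 𝒮 i) (t : 𝒮 j),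
    τ l (gradedMul 𝒮 h s t) = 𝓕.twistedComp h (τ i s) (τ j t))

/-- Multiplicative linear isomorphisms `S_n ≅ hom(F_n P, P)` make up an isomorphism of `S` with the
twisted endomorphism ring. -/
noncomputable def gradedAlgIso : GradedAlgIso 𝒮 (𝓕.twistedEndGrading P k) where
  toAlgEquiv := AlgEquiv.ofLinearEquiv (𝓕.twistedEndLinearEquiv τ)
    ((𝓕.twistedEndLinearEquiv_coe τ ⟨1, SetLike.one_mem_graded 𝒮⟩).trans (by rw [h1]; rfl))
    (fun x y => by
      induction x using DirectSum.Decomposition.inductionOn 𝒮 with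
      | zero => simp
      | add x x' hx hx' => rw [add_mul, map_add, map_add, add_mul, hx, hx']
      | @homogeneous i s =>
        induction y using DirectSum.Decomposition.inductionOn 𝒮 with
        | zero => simp
        | add y y' hy hy' => rw [mul_add, map_add, map_add, mul_add, hy, hy']
        | @homogeneous j t =>
          refine (𝓕.twistedEndLinearEquiv_coe τ (gradedMul 𝒮 rfl s t)).trans ?_
          rw [hmul, twistedEndLinearEquiv_coe, twistedEndLinearEquiv_coe]
          exact (DirectSum.of_mul_of _ _).symm)
  map_mem n s hs := ⟨τ n ⟨s, hs⟩, (𝓕.twistedEndLinearEquiv_coe τ ⟨s, hs⟩).symm⟩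

lemma gradedAlgIso_coe {n : ℤ} (s : 𝒮 n) :
    (𝓕.gradedAlgIso τ h1 hmul).toAlgEquiv (s : S) n = τ n s :=
  (congrArg (fun x : 𝓕.TwistedEnd P => x n) (𝓕.twistedEndLinearEquiv_coe τ s)).trans
    (DirectSum.of_eq_same _ _)

end ZSequence

/-! ### The equivalence as a twisted Hom functor -/

section Forward

variable {k : Type v} [CommRing k] {R : Type u} [Ring R] [Algebra k R]
  {𝒜 : ℤ → Submodule k R} [GradedAlgebra 𝒜] {S : Type u} [Ring S] [Algebra k S]
  {𝒮 : ℤ → Submodule k S} [GradedAlgebra 𝒮] (Φ : GrMod 𝒜 ≌ GrMod 𝒮)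
  [Φ.functor.Additive] [Φ.functor.Linear k]

/-- `S_n ≅ (Φ (Ψ S))_n ≅ hom(F^n (Ψ S), Ψ S)`. -/
noncomputable def pullbackComponent (n : ℤ) : 𝒮 n ≃ₗ[k]
    (ZSequence.ofEquivalence (pullback Φ (GrMod.shift 𝒮))).EndComp
      (Φ.inverse.obj (GrMod.regular 𝒮)) n :=
  (LinearEquiv.ofBijective (GrMod.act _ (zero_add n) (pullbackOne Φ))
    (isFreeOn_pullbackOne Φ (zero_add n))).trans (pullbackEval Φ _ n).symm

lemma pullbackEval_pullbackComponent (n : ℤ) (s : 𝒮 n) :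
    pullbackEval Φ _ n (pullbackComponent Φ n s) =
      GrMod.act _ (zero_add n) (pullbackOne Φ) s :=
  (pullbackEval Φ _ n).apply_symm_apply _

/-- The isomorphism of `S` with the twisted endomorphism ring of `Ψ S`, for the pulled back
shift. -/
noncomputable def pullbackGradedAlgIso : GradedAlgIso 𝒮
    (endGrading (pullback Φ (GrMod.shift 𝒮)) (Φ.inverse.obj (GrMod.regular 𝒮))) :=
  (ZSequence.ofEquivalence (pullback Φ (GrMod.shift 𝒮))).gradedAlgIso (pullbackComponent Φ)
    (by
      apply (pullbackEval Φ _ 0).injective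
      refine (pullbackEval_pullbackComponent Φ 0 _).trans ?_
      refine (GrMod.act_one _ _).trans ?_
      refine (pullbackGen_zero Φ).symm.trans ?_
      exact congrArg (fun f => GrMod.Hom.app f 0 (pullbackGen Φ 0)) (Φ.functor.map_id _).symm)
    (fun i j l h s t => by
      apply (pullbackEval Φ _ l).injective
      refine (pullbackEval_pullbackComponent Φ l _).trans ?_
      refine Eq.trans ?_ (pullbackEval_twistedComp Φ h _ _ t
        (pullbackEval_pullbackComponent Φ j t)).symm
      refine Eq.trans ?_ (congrArg (fun x => GrMod.act _ h x t)
        (pullbackEval_pullbackComponent Φ i s)).symm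
      exact (GrMod.act_act _ (zero_add i) h h (zero_add l) _ s t).symm)

lemma pullbackGradedAlgIso_coe {n : ℤ} (s : 𝒮 n) :
    (pullbackGradedAlgIso Φ).toAlgEquiv (s : S) n = pullbackComponent Φ n s :=
  ZSequence.gradedAlgIso_coe _ _ _ _ s

/-- Evaluation at the generators identifies the twisted Hom functor with `Φ`. -/
noncomputable def twistedHomPullbackIso :
    twistedHomFunctor (pullback Φ (GrMod.shift 𝒮)) (Φ.inverse.obj (GrMod.regular 𝒮)) ⋙
      (pullbackGradedAlgIso Φ).restrict ≅ Φ.functor :=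
  NatIso.ofComponents
    (fun N => GrMod.isoOfBijective
      { app := fun n => (pullbackEval Φ N n).toLinearMap
        app_act := fun {i j l} h f s => by
          refine (congrArg (fun b => pullbackEval Φ N l
            ((ZSequence.ofEquivalence (pullback Φ (GrMod.shift 𝒮))).twistedComp h f b))
              (pullbackGradedAlgIso_coe Φ s)).trans ?_
          exact pullbackEval_twistedComp Φ h f _ s (pullbackEval_pullbackComponent Φ j s) }
      (fun n => (pullbackEval Φ N n).bijective))
    (fun {N N'} g => by
      ext n f
      exact pullbackEval_comp Φ f g)

end Forward

theorem theorem2p6 {k : Type v} [CommRing k] {R S : Type u} [Ring R] [Algebra k R] [Ring S]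
    [Algebra k S] (𝒜 : ℤ → Submodule k R) [GradedAlgebra 𝒜] (𝒮 : ℤ → Submodule k S)
    [GradedAlgebra 𝒮] :
    (GradedEquivalent 𝒜 𝒮 ↔
      ∃ (P : GrMod 𝒜) (F : GrMod 𝒜 ≌ GrMod 𝒜) (_ : F.functor.Additive) (_ : F.functor.Linear k),
        P.FinitelyGenerated ∧ Projective P ∧ IsGenerative F P ∧
          Nonempty (GradedAlgIso 𝒮 (endGrading F P))) ∧
    ∀ (Φ : GrMod 𝒜 ≌ GrMod 𝒮) [Φ.functor.Additive] [Φ.functor.Linear k],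
      (Φ.inverse.obj (GrMod.regular 𝒮)).FinitelyGenerated ∧
      Projective (Φ.inverse.obj (GrMod.regular 𝒮)) ∧
      IsGenerative (pullback Φ (GrMod.shift 𝒮)) (Φ.inverse.obj (GrMod.regular 𝒮)) ∧
      ∃ σ : GradedAlgIso 𝒮
          (endGrading (pullback Φ (GrMod.shift 𝒮)) (Φ.inverse.obj (GrMod.regular 𝒮))),
        Nonempty (Φ.functor ≅
          twistedHomFunctor (pullback Φ (GrMod.shift 𝒮)) (Φ.inverse.obj (GrMod.regular 𝒮)) ⋙
            σ.restrict) := by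
  refine ⟨⟨?_, ?_⟩, ?_⟩
  · rintro ⟨Φ, _, _⟩
    have hcp := isCompactProjective_inverse_regular Φ
    exact ⟨_, pullback Φ (GrMod.shift 𝒮), inferInstance, inferInstance, hcp.finitelyGenerated,
      hcp.projective, isGenerative_pullback Φ, ⟨pullbackGradedAlgIso Φ⟩⟩
  · rintro ⟨P, F, _, _, hfg, hP, hF, ⟨σ⟩⟩
    exact gradedEquivalent_of_gradedAlgIso P F hfg hP hF σ
  · intro Φ _ _
    have hcp := isCompactProjective_inverse_regular Φ
    exact ⟨hcp.finitelyGenerated, hcp.projective, isGenerative_pullback Φ,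
      pullbackGradedAlgIso Φ, ⟨(twistedHomPullbackIso Φ).symm⟩⟩
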